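/- Let $M=(N,S)$ be any model of $\mathsf{RCA}_0$ (possibly with nonstandard numbers $N$; $S$ is its collection of sets). All notions below are interpreted in $M$: sets, sequences and paths are those in $S$ (coded by a bijective pairing function), and well-foundedness means that $S$ contains no infinite descending sequence. If $\prec$ is a binary relation on numbers, infinite sequences are compared by $\Lambda'\prec\Lambda$ iff for some $k$, $\Lambda'(i)=\Lambda(i)$ for all $i<k$ and $\Lambda'(k)\prec\Lambda(k)$. $\mathrm{MPP}$ (minimal path principle): if $T$ is an ill-founded tree of finite sequences of numbers and $\prec$ is a well-founded strict partial order, then there is a path $\Lambda$ through $T$ such that no path $\Lambda'$ through $T$ satisfies $\Lambda'\prec\Lambda$. $\mathrm{LPP}$ (leftmost path principle) is the case where $\prec$ is the usual order $<$ on the numbers. Let $\theta(x,Y,Z)$ be a universal $\Sigma^0_1$ formula. For a well-ordering $\alpha$ write $H(\alpha,Y,Z)$ if $Y=\{(m,j): j\in\alpha\wedge\theta(m,\{(n,i)\in Y: i\prec_\alpha j\},Z)\}$, that is, $Y$ is the hierarchy of jumps of $Z$ along $\alpha$. Put $\alpha^-=\beta$ if $\alpha=\beta+1$, and $\alpha^-=\alpha$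 if $\alpha$ is $0$ or a limit. A set $W$ is $\Sigma_\alpha$ in $Z$ if there is a set $Y$ with $H(\alpha^-,Y,Z)$ such that $W$ is computably enumerable in $Z\oplus Y$ (if $\alpha$ is a successor), respectively computable in $Z\oplus Y$ (if $\alpha$ is $0$ or a limit). $\Sigma_\alpha\text{-}\mathrm{MPP}$: if $T$ is an ill-founded tree and $\prec$ is a well-founded strict partial order, then there is a path $\Lambda$ through $T$ such that the hierarchy $Y$ with $H(\alpha^-,Y,T\oplus\Lambda)$ exists and no path $\Lambda'$ through $T$ that is $\Sigma_\alpha$ in $T\oplus\Lambda$ satisfies $\Lambda'\prec\Lambda$. $\Sigma_\alpha\text{-}\mathrm{LPP}$ is the case where $\prec$ is $<$. $\mathrm{TMPP}$ (respectively $\mathrm{TLPP}$) says that $\Sigma_\alpha\text{-}\mathrm{MPP}$ (respectively $\Sigma_\alpha\text{-}\mathrm{LPP}$) holds for every well-ordering $\alpha$. Theorem. In every model of $\mathsf{RCA}_0$ (equivalently, provably in $\mathsf{RCA}_0$): 1. $\mathrm{LPP}$ holds if and only if $\mathrm{MPP}$ holds; 2. for every $\alpha$ that is a well-ordering in the model,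 $\Sigma_\alpha\text{-}\mathrm{LPP}$ holds if and only if $\Sigma_\alpha\text{-}\mathrm{MPP}$ holds; 3. $\mathrm{TLPP}$ holds if and only if $\mathrm{TMPP}$ holds. -/

import Mathlib

/-! Second-order arithmetic. A structure for its language consists of a type `N` of numbers with
`0, 1, +, *, <` (not assumed to be standard) together with a collection `S : Set (Set N)` of subsets
of `N`, over which the set quantifiers range. -/

namespace SecondOrderArith

/-- Number terms; `var i` is the number variable `x_i`. -/
inductive NTerm : Type
  | var : ℕ → NTerm
  | zero : NTerm
  | one : NTerm
  | add : NTerm → NTerm → NTerm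
  | mul : NTerm → NTerm → NTerm

/-- Bounded (`Σ⁰₀`) formulas with number variables `x_i` and set variables `X_i`;
`ball i t φ` is `∀ x_i < t, φ`. -/
inductive BFormula : Type
  | eq : NTerm → NTerm → BFormula
  | lt : NTerm → NTerm → BFormula
  | mem : NTerm → ℕ → BFormula
  | neg : BFormula → BFormula
  | and : BFormula → BFormula → BFormula
  | ball : ℕ → NTerm → BFormula → BFormula

section Structures

variable {N : Type*} [Zero N] [One N] [Add N] [Mul N] [LT N]

/-- The value of a term under the assignment `v` of the number variables. -/
def NTerm.val (v : ℕ → N) : NTerm → N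
  | .var i => v i
  | .zero => 0
  | .one => 1
  | .add s t => s.val v + t.val v
  | .mul s t => s.val v * t.val v

/-- Satisfaction of a bounded formula under assignments of number and set variables. -/
def BFormula.Holds (V : ℕ → Set N) : BFormula → (ℕ → N) → Prop
  | .eq s t, v => s.val v = t.val v
  | .lt s t, v => s.val v < t.val v
  | .mem t i, v => t.val v ∈ V i
  | .neg φ, v => ¬ φ.Holds V v
  | .and φ ψ, v => φ.Holds V v ∧ ψ.Holds V v
  | .ball i t φ, v => ∀ a : N, a < t.val v → φ.Holds V (Function.update v i a)

/-- The `Σ⁰₁` formula `∃ x_0 φ`, at the value `n` of its distinguished variable `x_1`; the other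
variables are parameters. -/
def SigmaOne (φ : BFormula) (V : ℕ → Set N) (v : ℕ → N) (n : N) : Prop :=
  ∃ a : N, φ.Holds V (Function.update (Function.update v 1 n) 0 a)

/-- The `Π⁰₁` formula `∀ x_0 φ`, at the value `n` of its distinguished variable `x_1`. -/
def PiOne (φ : BFormula) (V : ℕ → Set N) (v : ℕ → N) (n : N) : Prop :=
  ∀ a : N, φ.Holds V (Function.update (Function.update v 1 n) 0 a)

/-- `(N, S)` is a model of `RCA₀`: the basic axioms, `Σ⁰₁` induction and `Δ⁰₁` comprehension, both
with number and set parameters. -/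
structure RCA0 (S : Set (Set N)) : Prop where
  sets_nonempty : S.Nonempty
  succ_ne_zero : ∀ n : N, n + 1 ≠ 0
  succ_inj : ∀ m n : N, m + 1 = n + 1 → m = n
  add_zero : ∀ m : N, m + 0 = m
  add_succ : ∀ m n : N, m + (n + 1) = (m + n) + 1
  mul_zero : ∀ m : N, m * 0 = 0
  mul_succ : ∀ m n : N, m * (n + 1) = m * n + m
  not_lt_zero : ∀ m : N, ¬ m < 0
  lt_succ_iff : ∀ m n : N, m < n + 1 ↔ m < n ∨ m = n
  sigmaOne_induction : ∀ (φ : BFormula) (V : ℕ → Set N) (v : ℕ → N), (∀ i, V i ∈ S) →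
    SigmaOne φ V v 0 → (∀ n : N, SigmaOne φ V v n → SigmaOne φ V v (n + 1)) →
    ∀ n : N, SigmaOne φ V v n
  deltaOne_comprehension : ∀ (φ ψ : BFormula) (V : ℕ → Set N) (v : ℕ → N), (∀ i, V i ∈ S) →
    (∀ n : N, SigmaOne φ V v n ↔ PiOne ψ V v n) → {n : N | SigmaOne φ V v n} ∈ S

/-! ### Pairs, finite and infinite sequences, trees -/

open Classical in
/-- A computable bijective pairing function (on the standard numbers it is `Nat.pair`). -/
noncomputable def pair (a b : N) : N := if a < b then b * b + a else a * a + a + b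

/-- Subsets of `N` viewed as binary relations. -/
def rel (X : Set N) (x y : N) : Prop := pair x y ∈ X

/-- Every number `c = (l, (a, b))` codes a finite sequence, of length `l`. -/
def SeqLen (c l : N) : Prop := ∃ a b : N, c = pair l (pair a b)

/-- The `i`-th entry of the sequence coded by `(l, (a, b))`, for `i < l`, is the remainder of `a`
modulo `1 + (i + 1) b` (Gödel's beta function). -/
def SeqEntry (c i x : N) : Prop :=
  ∃ l a b : N, c = pair l (pair a b) ∧ i < l ∧ x < 1 + (i + 1) * b ∧
    ∃ q : N, a = q * (1 + (i + 1) * b) + x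

/-- The sequence coded by `d` is an initial segment (possibly all) of that coded by `c`. -/
def InitSeg (d c : N) : Prop :=
  ∃ k l : N, SeqLen d k ∧ SeqLen c l ∧ (k < l ∨ k = l) ∧
    ∀ i : N, i < k → ∀ x : N, SeqEntry d i x ↔ SeqEntry c i x

/-- `T` is a tree of finite sequences: closed under initial segments. A sequence has more than one
code; taking `InitSeg` between sequences of the same length, all of them are in `T` or none is. -/
def IsTree (T : Set N) : Prop := ∀ c ∈ T, ∀ d : N, InitSeg d c → d ∈ T

/-- `Λ` is (the graph of) an infinite sequence of numbers, in the model. -/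
def IsInfSeq (S : Set (Set N)) (Λ : Set N) : Prop := Λ ∈ S ∧ ∀ n : N, ∃! x : N, pair n x ∈ Λ

/-- `c` codes the initial segment of length `n` of the infinite sequence `Λ`. -/
def CodesInit (Λ : Set N) (n c : N) : Prop :=
  SeqLen c n ∧ ∀ i : N, i < n → ∀ x : N, SeqEntry c i x ↔ pair i x ∈ Λ

/-- `Λ` is a path through `T` (in the model). -/
def IsPath (S : Set (Set N)) (T Λ : Set N) : Prop :=
  IsInfSeq S Λ ∧ ∀ n : N, ∃ c ∈ T, CodesInit Λ n c

/-- `T` is ill-founded (in the model). -/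
def IllFounded (S : Set (Set N)) (T : Set N) : Prop := ∃ Λ : Set N, IsPath S T Λ

/-- The extension of a relation `r` on numbers to infinite sequences: `Λ'` is below `Λ` if they
agree before some place `k`, and at `k` the value of `Λ'` is `r`-below that of `Λ`. -/
def LexBelow (r : N → N → Prop) (Λ' Λ : Set N) : Prop :=
  ∃ k x y : N, pair k x ∈ Λ' ∧ pair k y ∈ Λ ∧ r x y ∧
    ∀ i : N, i < k → ∀ z : N, pair i z ∈ Λ' ↔ pair i z ∈ Λ

/-- `P` is a (strict) partial order. -/
def IsPartialOrder (P : Set N) : Prop :=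
  (∀ x y z : N, rel P x y → rel P y z → rel P x z) ∧ ∀ x : N, ¬ rel P x x

/-- `P` is well-founded in the model: it has no infinite descending sequence in the model. -/
def WellFoundedIn (S : Set (Set N)) (P : Set N) : Prop :=
  ¬ ∃ Λ : Set N, IsInfSeq S Λ ∧
    ∀ i x y : N, pair i x ∈ Λ → pair (i + 1) y ∈ Λ → rel P y x

/-! ### The minimal and the leftmost path principle -/

/-- `T` has a path that is minimal with respect to `r`. -/
def HasMinimalPath (S : Set (Set N)) (r : N → N → Prop) (T : Set N) : Prop :=
  ∃ Λ : Set N, IsPath S T Λ ∧ ¬ ∃ Λ' : Set N, IsPath S T Λ' ∧ LexBelow r Λ' Λ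

/-- The minimal path principle holds in `(N, S)`. -/
def MPP (S : Set (Set N)) : Prop :=
  ∀ T ∈ S, IsTree T → IllFounded S T →
    ∀ P ∈ S, IsPartialOrder P → WellFoundedIn S P → HasMinimalPath S (rel P) T

/-- The leftmost path principle holds in `(N, S)`. -/
def LPP (S : Set (Set N)) : Prop :=
  ∀ T ∈ S, IsTree T → IllFounded S T → HasMinimalPath S (fun x y : N => x < y) T

/-! ### Relative computability and the jump hierarchy -/

/-- The join `X ⊕ Y`: even numbers for `X`, odd numbers for `Y`. -/
def join (X Y : Set N) : Set N :=
  {z | (∃ x ∈ X, z = x + x) ∨ ∃ y ∈ Y, z = y + y + 1}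

/-- `W` is computably enumerable in `Z`: `Σ⁰₁` definable from numbers and the set `Z`. -/
def CEIn (W Z : Set N) : Prop :=
  ∃ (φ : BFormula) (v : ℕ → N), W = {n | SigmaOne φ (fun _ => Z) v n}

/-- `W` is computable in `Z`: `W` and its complement are computably enumerable in `Z`. -/
def ComputableIn (W Z : Set N) : Prop := CEIn W Z ∧ CEIn Wᶜ Z

/-- The assignment of `Y` to the set variable `X_0` and of `Z` to all others. -/
def twoSets (Y Z : Set N) : ℕ → Set N
  | 0 => Y
  | _ + 1 => Z

/-- The `Σ⁰₁` formula `θ(m, Y, Z)`, that is `∃ x_0 θ` with `x_1 = m`, `X_0 = Y`, `X_1 = Z`, with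
no parameters: variables other than the displayed ones get default values. -/
def SigmaOneAt (θ : BFormula) (m : N) (Y Z : Set N) : Prop :=
  SigmaOne θ (twoSets Y Z) (fun _ => 0) m

/-- `θ(x, Y, Z)` is a universal `Σ⁰₁` formula: each `Σ⁰₁` formula `φ(m, Y, Z)`, possibly with number
parameters, is `θ((e, m), Y, Z)` for some index `e`. -/
def IsUniversal (S : Set (Set N)) (θ : BFormula) : Prop :=
  ∀ (φ : BFormula) (v : ℕ → N), ∃ e : N, ∀ m : N, ∀ Y ∈ S, ∀ Z ∈ S,
    SigmaOne φ (twoSets Y Z) v m ↔ SigmaOneAt θ (pair e m) Y Z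

/-- `(A, R)` is a well-ordering in the model: `R` is a set of the model that strictly linearly
orders its domain `A` and is well-founded in the model. If `A` has at least two elements then `A` is
the field of `R`; it is given separately because the strict orders with no and with one element are
both the empty relation. -/
structure IsWO (S : Set (Set N)) (A R : Set N) : Prop where
  mem : R ∈ S
  partialOrder : IsPartialOrder R
  dom : ∀ x y : N, rel R x y → x ∈ A ∧ y ∈ A
  total : ∀ x ∈ A, ∀ y ∈ A, rel R x y ∨ x = y ∨ rel R y x
  wellFounded : WellFoundedIn S R

/-- `(Y)^j = {(m, i) ∈ Y | i ≺ j}`. -/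
def part (R Y : Set N) (j : N) : Set N := {z | z ∈ Y ∧ ∃ m i : N, z = pair m i ∧ rel R i j}

/-- `H(A, Y, Z)`: `Y` is the hierarchy of jumps of `Z` along `A` (ordered by `R`), that is,
`Y = {(m, j) | j ∈ A and θ(m, (Y)^j, Z)}`. -/
def IsHierarchy (θ : BFormula) (A R Y Z : Set N) : Prop :=
  ∀ m j : N, pair m j ∈ Y ↔ j ∈ A ∧ SigmaOneAt θ m (part R Y j) Z

/-- `t` is the largest element of `(A, R)`. -/
def IsLargest (A R : Set N) (t : N) : Prop := t ∈ A ∧ ∀ x ∈ A, x ≠ t → rel R x t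

/-- The order type `(A, R)` is a successor. -/
def IsSuccOrder (A R : Set N) : Prop := ∃ t : N, IsLargest A R t

/-- The domain of the order along which jumps are iterated in the definition of `Σ_α`:
`β` if `α = β + 1`, and `α` itself if `α` is `0` or a limit. -/
def lower (A R : Set N) : Set N := {x | x ∈ A ∧ ¬ IsLargest A R x}

/-- `Y ∈ S` is the jump hierarchy on `Z` used for `Σ_α`, where `α = (A, R)`. -/
def IsSigmaHierarchy (S : Set (Set N)) (θ : BFormula) (A R Y Z : Set N) : Prop :=
  Y ∈ S ∧ IsHierarchy θ (lower A R) R Y Z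

/-- `W` is `Σ_α` in `Z`, where `α = (A, R)`. For `α = β + 1`: computably enumerable in the hierarchy
of jumps of `Z` along `β`; for `α` a limit or `0`: computable in the hierarchy along `α`. The
hierarchy is joined with `Z` because along the empty order it is empty, whereas the zeroth jump of
`Z` is `Z`; along any other order it computes `Z`. -/
def SigmaIn (S : Set (Set N)) (θ : BFormula) (A R W Z : Set N) : Prop :=
  ∃ Y : Set N, IsSigmaHierarchy S θ A R Y Z ∧
    ((IsSuccOrder A R ∧ CEIn W (join Z Y)) ∨ (¬ IsSuccOrder A R ∧ ComputableIn W (join Z Y)))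

/-! ### The relative principles -/

/-- `T` has a path `Λ` such that no path which is `Σ_α` in `T ⊕ Λ` is `r`-below `Λ`. The notion
`Σ_α` in `T ⊕ Λ` presupposes the jump hierarchy on `T ⊕ Λ`, whose existence is part of the claim. -/
def HasSigmaMinimalPath (S : Set (Set N)) (θ : BFormula) (A R : Set N) (r : N → N → Prop)
    (T : Set N) : Prop :=
  ∃ Λ : Set N, IsPath S T Λ ∧ (∃ Y : Set N, IsSigmaHierarchy S θ A R Y (join T Λ)) ∧
    ¬ ∃ Λ' : Set N, IsPath S T Λ' ∧ SigmaIn S θ A R Λ' (join T Λ) ∧ LexBelow r Λ' Λ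

/-- The `Σ_α`-relative minimal path principle holds in `(N, S)`, where `α = (A, R)`. -/
def SigmaMPP (S : Set (Set N)) (θ : BFormula) (A R : Set N) : Prop :=
  ∀ T ∈ S, IsTree T → IllFounded S T →
    ∀ P ∈ S, IsPartialOrder P → WellFoundedIn S P → HasSigmaMinimalPath S θ A R (rel P) T

/-- The `Σ_α`-relative leftmost path principle holds in `(N, S)`, where `α = (A, R)`. -/
def SigmaLPP (S : Set (Set N)) (θ : BFormula) (A R : Set N) : Prop :=
  ∀ T ∈ S, IsTree T → IllFounded S T →
    HasSigmaMinimalPath S θ A R (fun x y : N => x < y) T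

/-- The transfinite minimal path principle holds in `(N, S)`. -/
def TMPP (S : Set (Set N)) (θ : BFormula) : Prop :=
  ∀ A R : Set N, IsWO S A R → SigmaMPP S θ A R

/-- The transfinite leftmost path principle holds in `(N, S)`. -/
def TLPP (S : Set (Set N)) (θ : BFormula) : Prop :=
  ∀ A R : Set N, IsWO S A R → SigmaLPP S θ A R

end Structures

end SecondOrderArith

/-! The leftmost principles are instances of the minimal ones, as the usual order is a
well-founded partial order of the model.

For the converse let `T` be a tree and `P` a well-founded partial order. The tree `guessTree T P`
has as paths the sequences of guesses at a path through `T`: each entry carries a finite sequence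
in `T` and a bit. If the bit is `1`, the last entry of that sequence is final, and the next guess
extends it by one entry; if it is `0`, the next guess replaces its last entry by a `P`-smaller
number. As `P` has no descending sequence in the model, every guess becomes final after finitely
many steps (`exists_final`), so a path `y` computes a path `h` through `T`. If some path `h'` were
`P`-below `h`, say at `k`, then the bit of `y` at the step that makes the `k`-th entry final could
be changed from `1` to `0` and the sequence continued along `h'`; the result is a path to the left
of `y` (`exists_path_of_guessTree`). So if `y` is leftmost, then `h` is minimal. The new path is
computable from `y` and `h'`, which is what the relative principles need.

In the relative case each entry of `y` also records one bit of `T`, so that `y` computes `T ⊕ h`.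
A hierarchy of jumps of `Z'` computes one of each `Z` computable in `Z'`, by the recursion theorem
(`IsHierarchy.exists_of_computable`), and hierarchies of jumps along well-orderings are unique
(`IsHierarchy.unique`). Hence a path `Σ_α` in `T ⊕ h` is `Σ_α` in `guessTree T P ⊕ y`, and so is
the path to the left of `y` that it yields.

All this takes place in an arbitrary model of `RCA₀`. The numbers of the model form an ordered
semiring (`RCA0.toRCA0Numbers`). Definability is handled by the classes `Sg`, `Pg` and `Fn` of
predicates and functions on contexts that are `Σ⁰₁`, `Π⁰₁` and computable. Their closure
properties, among them `Σ⁰₁` collection, are instances, so that definability is found by instance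
search; `BFormula.sg_pg_holds` substitutes computable sets and functions into formulas. Finite
sequences are obtained from the beta function (`exists_seq`), with explicit Bézout coefficients
for the moduli. -/

set_option linter.unusedSectionVars false

namespace SecondOrderArith

universe u w

/-! ### The numbers of a model as an ordered semiring -/

/-- The numbers of a model of `RCA₀`, as an ordered commutative semiring. -/
class RCA0Numbers (N : Type u) extends CommSemiring N, LinearOrder N, IsStrictOrderedRing N,
    CanonicallyOrderedAdd N where
  model : ∃ S : Set (Set N), RCA0 S

namespace RCA0

section Raw

variable {N : Type u} [Zero N] [One N] [Add N] [Mul N] [LT N] {S : Set (Set N)}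

/-- Induction for a bounded formula in the variable `x_1`. -/
theorem induction_of_formula (hS : RCA0 S) (φ : BFormula) (v : ℕ → N) (P : N → Prop)
    (h : ∀ n a, φ.Holds (fun _ => hS.sets_nonempty.choose)
      (Function.update (Function.update v 1 n) 0 a) ↔ P n)
    (h0 : P 0) (hs : ∀ n, P n → P (n + 1)) (n : N) : P n := by
  have key : ∀ n, SigmaOne φ (fun _ => hS.sets_nonempty.choose) v n ↔ P n := fun n =>
    ⟨fun ⟨a, ha⟩ => (h n a).1 ha, fun hn => ⟨0, (h n 0).2 hn⟩⟩
  exact (key n).1 (hS.sigmaOne_induction φ _ v (fun _ => hS.sets_nonempty.choose_spec)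
    ((key 0).2 h0) (fun m hm => (key _).2 (hs m ((key m).1 hm))) n)

/-- The assignment `x_2 = a`, `x_3 = b`. -/
def params (a b : N) : ℕ → N
  | 2 => a
  | 3 => b
  | _ => 0

theorem zero_add (hS : RCA0 S) (n : N) : 0 + n = n :=
  hS.induction_of_formula (.eq (.add .zero (.var 1)) (.var 1)) (params 0 0) (fun n => 0 + n = n)
    (fun n a => by simp [BFormula.Holds, NTerm.val]) (hS.add_zero 0)
    (fun n h => by rw [hS.add_succ, h]) n

theorem succ_add (hS : RCA0 S) (m n : N) : (m + 1) + n = (m + n) + 1 :=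
  hS.induction_of_formula (.eq (.add (.add (.var 2) .one) (.var 1))
      (.add (.add (.var 2) (.var 1)) .one)) (params m 0)
    (fun n => (m + 1) + n = (m + n) + 1)
    (fun n a => by simp [BFormula.Holds, NTerm.val, params]) (by rw [hS.add_zero, hS.add_zero])
    (fun n h => by rw [hS.add_succ, h, hS.add_succ]) n

theorem add_comm (hS : RCA0 S) (m n : N) : m + n = n + m :=
  hS.induction_of_formula (.eq (.add (.var 2) (.var 1)) (.add (.var 1) (.var 2))) (params m 0)
    (fun n => m + n = n + m)
    (fun n a => by simp [BFormula.Holds, NTerm.val, params])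
    (by rw [hS.add_zero, hS.zero_add])
    (fun n h => by rw [hS.add_succ, h, hS.succ_add]) n

theorem add_assoc (hS : RCA0 S) (a b n : N) : a + b + n = a + (b + n) :=
  hS.induction_of_formula (.eq (.add (.add (.var 2) (.var 3)) (.var 1))
      (.add (.var 2) (.add (.var 3) (.var 1)))) (params a b)
    (fun n => a + b + n = a + (b + n))
    (fun n a => by simp [BFormula.Holds, NTerm.val, params])
    (by rw [hS.add_zero, hS.add_zero])
    (fun n h => by rw [hS.add_succ, hS.add_succ, hS.add_succ, h]) n

theorem add_right_cancel (hS : RCA0 S) {a b : N} (n : N) : a + n = b + n → a = b :=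
  hS.induction_of_formula (.neg (.and (.eq (.add (.var 2) (.var 1)) (.add (.var 3) (.var 1)))
      (.neg (.eq (.var 2) (.var 3))))) (params a b)
    (fun n => a + n = b + n → a = b)
    (fun n a => by simp [BFormula.Holds, NTerm.val, params])
    (by rw [hS.add_zero, hS.add_zero]; exact id)
    (fun n h e => h (by rw [hS.add_succ, hS.add_succ] at e; exact hS.succ_inj _ _ e)) n

theorem zero_mul (hS : RCA0 S) (n : N) : 0 * n = 0 :=
  hS.induction_of_formula (.eq (.mul .zero (.var 1)) .zero) (params 0 0) (fun n => 0 * n = 0)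
    (fun n a => by simp [BFormula.Holds, NTerm.val]) (hS.mul_zero 0)
    (fun n h => by rw [hS.mul_succ, h, hS.add_zero]) n

theorem succ_mul (hS : RCA0 S) (m n : N) : (m + 1) * n = m * n + n :=
  hS.induction_of_formula (.eq (.mul (.add (.var 2) .one) (.var 1))
      (.add (.mul (.var 2) (.var 1)) (.var 1))) (params m 0)
    (fun n => (m + 1) * n = m * n + n)
    (fun n a => by simp [BFormula.Holds, NTerm.val, params])
    (by rw [hS.mul_zero, hS.mul_zero, hS.add_zero])
    (fun n h => by
      have e : m * n + n + m = m * n + m + n := by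
        rw [hS.add_assoc, hS.add_assoc, hS.add_comm n m]
      rw [hS.mul_succ, h, hS.mul_succ, hS.add_succ (m * n + n), hS.add_succ (m * n + m), e]) n

theorem mul_comm (hS : RCA0 S) (m n : N) : m * n = n * m :=
  hS.induction_of_formula (.eq (.mul (.var 2) (.var 1)) (.mul (.var 1) (.var 2))) (params m 0)
    (fun n => m * n = n * m)
    (fun n a => by simp [BFormula.Holds, NTerm.val, params])
    (by rw [hS.mul_zero, hS.zero_mul])
    (fun n h => by rw [hS.mul_succ, h, hS.succ_mul]) n

theorem mul_add (hS : RCA0 S) (a b n : N) : a * (b + n) = a * b + a * n :=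
  hS.induction_of_formula (.eq (.mul (.var 2) (.add (.var 3) (.var 1)))
      (.add (.mul (.var 2) (.var 3)) (.mul (.var 2) (.var 1)))) (params a b)
    (fun n => a * (b + n) = a * b + a * n)
    (fun n a => by simp [BFormula.Holds, NTerm.val, params])
    (by rw [hS.add_zero, hS.mul_zero, hS.add_zero])
    (fun n h => by rw [hS.add_succ, hS.mul_succ, hS.mul_succ, h, hS.add_assoc]) n

theorem mul_assoc (hS : RCA0 S) (a b n : N) : a * b * n = a * (b * n) :=
  hS.induction_of_formula (.eq (.mul (.mul (.var 2) (.var 3)) (.var 1))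
      (.mul (.var 2) (.mul (.var 3) (.var 1)))) (params a b)
    (fun n => a * b * n = a * (b * n))
    (fun n a => by simp [BFormula.Holds, NTerm.val, params])
    (by rw [hS.mul_zero, hS.mul_zero, hS.mul_zero])
    (fun n h => by rw [hS.mul_succ, hS.mul_succ, hS.mul_add, h]) n

theorem mul_one (hS : RCA0 S) (a : N) : a * 1 = a := by
  have := hS.mul_succ a 0
  rwa [hS.zero_add, hS.mul_zero, hS.zero_add] at this

theorem exists_succ_of_ne_zero (hS : RCA0 S) (n : N) : n ≠ 0 → ∃ k, n = k + 1 := by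
  have := hS.sigmaOne_induction (.neg (.and (.neg (.eq (.var 1) .zero))
    (.neg (.eq (.var 1) (.add (.var 0) .one))))) _ (params 0 0)
    (fun _ => hS.sets_nonempty.choose_spec)
  simp only [SigmaOne, BFormula.Holds, NTerm.val, Function.update_self, ne_eq, one_ne_zero,
    not_false_eq_true, Function.update_of_ne, not_and, not_not] at this
  intro hn
  obtain ⟨k, hk⟩ := this ⟨0, fun h => (h trivial).elim⟩ (fun n _ => ⟨n, fun _ => rfl⟩) n
  exact ⟨k, hk hn⟩

theorem lt_add_succ (hS : RCA0 S) (m d : N) : m < m + (d + 1) :=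
  hS.induction_of_formula (.lt (.var 2) (.add (.var 2) (.add (.var 1) .one))) (params m 0)
    (fun d => m < m + (d + 1))
    (fun n a => by simp [BFormula.Holds, NTerm.val, params])
    (by rw [hS.zero_add, hS.lt_succ_iff]; exact .inr rfl)
    (fun d h => by rw [hS.add_succ m (d + 1), hS.lt_succ_iff]; exact .inl h) d

theorem exists_add_of_lt (hS : RCA0 S) (m n : N) : m < n → ∃ d, m + (d + 1) = n := by
  have := hS.sigmaOne_induction (.neg (.and (.lt (.var 2) (.var 1))
    (.neg (.eq (.add (.var 2) (.add (.var 0) .one)) (.var 1))))) _ (params m 0)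
    (fun _ => hS.sets_nonempty.choose_spec)
  simp only [SigmaOne, BFormula.Holds, NTerm.val, Function.update_self, ne_eq, one_ne_zero,
    not_false_eq_true, Function.update_of_ne, not_and, not_not, params,
    show ((2 : ℕ) = 0) = False by simp, show ((2 : ℕ) = 1) = False by simp] at this
  intro hn
  obtain ⟨k, hk⟩ := this ⟨0, fun h => (hS.not_lt_zero _ h).elim⟩ (fun n ⟨d, hd⟩ => by
    by_cases h : m < n
    · exact ⟨d + 1, fun _ => by rw [hS.add_succ, hd h]⟩
    · refine ⟨0, fun h' => ?_⟩
      rcases (hS.lt_succ_iff _ _).1 h' with h' | rfl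
      · exact (h h').elim
      · rw [hS.zero_add]) n
  exact ⟨k, hk hn⟩

theorem lt_iff_exists_add (hS : RCA0 S) (m n : N) : m < n ↔ ∃ d, m + (d + 1) = n :=
  ⟨hS.exists_add_of_lt m n, by rintro ⟨d, rfl⟩; exact hS.lt_add_succ m d⟩

theorem lt_trichotomy (hS : RCA0 S) (m n : N) : m < n ∨ m = n ∨ n < m :=
  hS.induction_of_formula (.neg (.and (.neg (.lt (.var 2) (.var 1)))
      (.and (.neg (.eq (.var 2) (.var 1))) (.neg (.lt (.var 1) (.var 2)))))) (params m 0)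
    (fun n => m < n ∨ m = n ∨ n < m)
    (fun n a => by simp [BFormula.Holds, NTerm.val, params]; tauto)
    (by
      by_cases h : m = 0
      · exact .inr (.inl h)
      · obtain ⟨k, rfl⟩ := hS.exists_succ_of_ne_zero m h
        refine .inr (.inr ?_)
        have := hS.lt_add_succ 0 k
        rwa [hS.zero_add] at this)
    (fun n h => by
      rcases h with h | rfl | h
      · exact .inl ((hS.lt_succ_iff _ _).2 (.inl h))
      · exact .inl ((hS.lt_succ_iff _ _).2 (.inr rfl))
      · obtain ⟨d, rfl⟩ := hS.exists_add_of_lt _ _ h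
        by_cases hd : d = 0
        · subst hd; exact .inr (.inl (by rw [hS.zero_add]))
        · obtain ⟨k, rfl⟩ := hS.exists_succ_of_ne_zero d hd
          refine .inr (.inr ((hS.lt_iff_exists_add _ _).2 ⟨k, ?_⟩))
          rw [hS.succ_add, hS.add_succ n (k + 1)]) n

theorem lt_irrefl (hS : RCA0 S) (m : N) : ¬ m < m := by
  intro h
  obtain ⟨d, hd⟩ := hS.exists_add_of_lt _ _ h
  refine hS.succ_ne_zero d (hS.add_right_cancel m ?_)
  rw [hS.add_comm, hd, hS.zero_add]

theorem lt_trans (hS : RCA0 S) {a b c : N} (h : a < b) (h' : b < c) : a < c := by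
  obtain ⟨d, rfl⟩ := hS.exists_add_of_lt _ _ h
  obtain ⟨e, rfl⟩ := hS.exists_add_of_lt _ _ h'
  exact (hS.lt_iff_exists_add _ _).2 ⟨d + 1 + e, by
    rw [hS.add_succ (a + (d + 1)), hS.add_assoc a, hS.add_succ a]⟩

theorem add_lt_add_left (hS : RCA0 S) {a b : N} (h : a < b) (c : N) : c + a < c + b := by
  obtain ⟨d, rfl⟩ := hS.exists_add_of_lt _ _ h
  exact (hS.lt_iff_exists_add _ _).2 ⟨d, hS.add_assoc _ _ _⟩

theorem mul_lt_mul_left (hS : RCA0 S) {a b c : N} (hc : 0 < c) (h : a < b) : c * a < c * b := by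
  obtain ⟨d, rfl⟩ := hS.exists_add_of_lt _ _ h
  obtain ⟨k, rfl⟩ := hS.exists_add_of_lt _ _ hc
  rw [hS.zero_add, hS.mul_add, hS.succ_mul k (d + 1)]
  exact (hS.lt_iff_exists_add _ _).2 ⟨k * (d + 1) + d, by rw [hS.add_succ (k * (d + 1)) d]⟩

open Classical in
/-- The numbers of a model of `RCA₀`, with the operations and the order of the model. -/
@[reducible] noncomputable def toRCA0Numbers (hS : RCA0 S) : RCA0Numbers N where
  add_assoc := hS.add_assoc
  zero_add := hS.zero_add
  add_zero := hS.add_zero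
  add_comm := hS.add_comm
  nsmul := nsmulRec
  left_distrib := hS.mul_add
  right_distrib a b c := by rw [hS.mul_comm, hS.mul_add, hS.mul_comm c a, hS.mul_comm c b]
  zero_mul := hS.zero_mul
  mul_zero := hS.mul_zero
  mul_assoc := hS.mul_assoc
  one_mul a := by rw [hS.mul_comm, hS.mul_one]
  mul_one := hS.mul_one
  mul_comm := hS.mul_comm
  le a b := a < b ∨ a = b
  le_refl a := .inr rfl
  le_trans a b c := by
    rintro (h | rfl) (h' | rfl)
    exacts [.inl (hS.lt_trans h h'), .inl h, .inl h', .inr rfl]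
  lt_iff_le_not_ge a b := by
    constructor
    · refine fun h => ⟨.inl h, ?_⟩
      rintro (h' | rfl)
      exacts [hS.lt_irrefl _ (hS.lt_trans h h'), hS.lt_irrefl _ h]
    · rintro ⟨h | rfl, h'⟩
      exacts [h, (h' (.inr rfl)).elim]
  le_antisymm a b := by
    rintro (h | rfl) (h' | h')
    exacts [(hS.lt_irrefl _ (hS.lt_trans h h')).elim, h'.symm, rfl, rfl]
  le_total a b := by
    rcases hS.lt_trichotomy a b with h | h | h
    exacts [.inl (.inl h), .inl (.inr h), .inr (.inl h)]
  toDecidableLE := Classical.decRel _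
  add_le_add_left a b h c := by
    rcases h with h | rfl
    · rw [hS.add_comm a, hS.add_comm b]; exact .inl (hS.add_lt_add_left h c)
    · exact .inr rfl
  le_of_add_le_add_left a b c h := by
    rcases hS.lt_trichotomy b c with h' | h' | h'
    · exact .inl h'
    · exact .inr h'
    · have h' := hS.add_lt_add_left h' a
      rcases h with h | h
      · exact (hS.lt_irrefl _ (hS.lt_trans h h')).elim
      · rw [h] at h'; exact (hS.lt_irrefl _ h').elim
  zero_le_one := by
    have := hS.lt_add_succ 0 0
    rw [hS.zero_add, hS.zero_add] at this; exact .inl this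
  exists_pair_ne := ⟨0, 1, fun h => hS.succ_ne_zero 0 (by rw [hS.zero_add]; exact h.symm)⟩
  mul_lt_mul_of_pos_left a ha b c h := hS.mul_lt_mul_left ha h
  mul_lt_mul_of_pos_right a ha b c h := by
    change b * a < c * a
    rw [hS.mul_comm b, hS.mul_comm c]; exact hS.mul_lt_mul_left ha h
  exists_add_of_le {a b} h := by
    rcases h with h | rfl
    · obtain ⟨d, rfl⟩ := hS.exists_add_of_lt _ _ h; exact ⟨_, rfl⟩
    · exact ⟨0, (hS.add_zero _).symm⟩
  le_add_self a b := by
    by_cases h : b = 0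
    · subst h; rw [hS.zero_add]; exact .inr rfl
    · obtain ⟨k, rfl⟩ := hS.exists_succ_of_ne_zero _ h
      rw [hS.add_comm]; exact .inl (hS.lt_add_succ _ _)
  le_self_add a b := by
    by_cases h : b = 0
    · subst h; rw [hS.add_zero]; exact .inr rfl
    · obtain ⟨k, rfl⟩ := hS.exists_succ_of_ne_zero _ h
      exact .inl (hS.lt_add_succ _ _)
  model := ⟨S, hS⟩

end Raw
end RCA0

/-! ### Renaming of variables -/

/-- Renaming of the variables of a term. -/
def NTerm.rename (ρ : ℕ → ℕ) : NTerm → NTerm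
  | .var i => .var (ρ i)
  | .zero => .zero
  | .one => .one
  | .add s t => .add (s.rename ρ) (t.rename ρ)
  | .mul s t => .mul (s.rename ρ) (t.rename ρ)

/-- Renaming of the number variables of a formula, free and bound. -/
def BFormula.rename (ρ : ℕ → ℕ) : BFormula → BFormula
  | .eq s t => .eq (s.rename ρ) (t.rename ρ)
  | .lt s t => .lt (s.rename ρ) (t.rename ρ)
  | .mem t i => .mem (t.rename ρ) i
  | .neg φ => .neg (φ.rename ρ)
  | .and φ ψ => .and (φ.rename ρ) (ψ.rename ρ)
  | .ball i t φ => .ball (ρ i) (t.rename ρ) (φ.rename ρ)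

section Raw

variable {N : Type u} [Zero N] [One N] [Add N] [Mul N] [LT N]

theorem NTerm.val_rename (ρ : ℕ → ℕ) (v : ℕ → N) (t : NTerm) :
    (t.rename ρ).val v = t.val (v ∘ ρ) := by
  induction t with
  | var | zero | one => rfl
  | add s t hs ht | mul s t hs ht => simp only [rename, val, hs, ht]

theorem BFormula.holds_rename {ρ : ℕ → ℕ} (hρ : ρ.Injective) (V : ℕ → Set N) (φ : BFormula)
    (v : ℕ → N) : (φ.rename ρ).Holds V v ↔ φ.Holds V (v ∘ ρ) := by
  induction φ generalizing v with
  | eq | lt | mem => simp only [rename, Holds, NTerm.val_rename]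
  | neg φ h => simp only [rename, Holds, h]
  | and φ ψ h h' => simp only [rename, Holds, h, h']
  | ball i t φ h =>
    simp only [rename, Holds, NTerm.val_rename, h, Function.update_comp_eq_of_injective _ hρ]

/-! ### Bounded definability -/

/-- The stream `a, v 0, v 1, …`: the context `v` extended by a bound variable. -/
def push (a : N) (v : ℕ → N) : ℕ → N
  | 0 => a
  | i + 1 => v i

/-- The stream without its first entry: the context without the innermost bound variable. -/
def tail (v : ℕ → N) : ℕ → N := fun i => v (i + 1)

@[simp] theorem push_zero (a : N) (v : ℕ → N) : push a v 0 = a := rfl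

@[simp] theorem push_succ (a : N) (v : ℕ → N) (i : ℕ) : push a v (i + 1) = v i := rfl

@[simp] theorem tail_push (a : N) (v : ℕ → N) : tail (push a v) = v := rfl

/-- The assignment that gives the context `v` to the even variables and the parameters `p` to the
odd ones. -/
def interleave (v p : ℕ → N) (k : ℕ) : N := if k % 2 = 0 then v (k / 2) else p (k / 2)

theorem interleave_even (v p : ℕ → N) (i : ℕ) : interleave v p (2 * i) = v i := by
  simp [interleave]

theorem interleave_odd (v p : ℕ → N) (i : ℕ) : interleave v p (2 * i + 1) = p i := by
  have h : (2 * i + 1) / 2 = i := by omega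
  have h' : (2 * i + 1) % 2 = 1 := by omega
  simp [interleave, h, h']

theorem ext_even_odd {v v' : ℕ → N} (h : ∀ i, v (2 * i) = v' (2 * i))
    (h' : ∀ i, v (2 * i + 1) = v' (2 * i + 1)) : v = v' := by
  funext i
  rcases Nat.even_or_odd' i with ⟨k, rfl | rfl⟩
  exacts [h k, h' k]

/-- A formula can be rewritten so that its context and its parameters are read off from other
places of a context and of a parameter list. -/
theorem BFormula.exists_rename (φ : BFormula) {σ τ : ℕ → ℕ} (hσ : σ.Injective)
    (hτ : τ.Injective) : ∃ φ' : BFormula, ∀ (V : ℕ → Set N) (v p : ℕ → N),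
      φ'.Holds V (interleave v p) ↔ φ.Holds V (interleave (v ∘ σ) (p ∘ τ)) := by
  let ρ : ℕ → ℕ := fun k => if k % 2 = 0 then 2 * σ (k / 2) else 2 * τ (k / 2) + 1
  have hρ : ρ.Injective := by
    intro a b h
    simp only [ρ] at h
    split_ifs at h with h1 h2 h2
    · have := @hσ (a / 2) (b / 2) (by omega); omega
    · omega
    · omega
    · have := @hτ (a / 2) (b / 2) (by omega); omega
  refine ⟨φ.rename ρ, fun V v p => ?_⟩
  rw [holds_rename hρ]
  have : interleave v p ∘ ρ = interleave (v ∘ σ) (p ∘ τ) := by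
    refine ext_even_odd (fun i => ?_) fun i => ?_
    · rw [interleave_even]; simp [ρ, interleave_even]
    · rw [interleave_odd]
      have h : (2 * i + 1) / 2 = i := by omega
      have h' : (2 * i + 1) % 2 = 1 := by omega
      simp [ρ, h, h', interleave_odd]
  rw [this]

/-- The innermost variable of the context of a formula can be moved to the parameters. -/
theorem BFormula.exists_shift (φ : BFormula) : ∃ φ' : BFormula, ∀ (V : ℕ → Set N) (a : N)
    (v p : ℕ → N), φ'.Holds V (interleave v (push a p)) ↔ φ.Holds V (interleave (push a v) p) := by
  let ρ : ℕ → ℕ := fun k => if k = 0 then 1 else if k % 2 = 0 then k - 2 else k + 2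
  have hρ : ρ.Injective := by
    intro a b h
    simp only [ρ] at h
    split_ifs at h <;> omega
  refine ⟨φ.rename ρ, fun V a v p => ?_⟩
  rw [holds_rename hρ]
  have : interleave v (push a p) ∘ ρ = interleave (push a v) p := by
    refine ext_even_odd (fun i => ?_) fun i => ?_
    · rw [interleave_even]
      rcases i with _ | i
      · have : ρ (2 * 0) = 2 * 0 + 1 := rfl
        rw [Function.comp, this, interleave_odd]; rfl
      · have : ρ (2 * (i + 1)) = 2 * i := by simp [ρ]; omega
        rw [Function.comp, this, interleave_even]; rfl
    · have : ρ (2 * i + 1) = 2 * (i + 1) + 1 := by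
        have h : (2 * i + 1) % 2 = 1 := by omega
        simp [ρ, h]; omega
      rw [interleave_odd, Function.comp, this, interleave_odd]; rfl
  rw [this]

variable {I : Type w}

/-- `P` is a predicate on contexts, uniformly definable from the sets `F i` by a bounded formula
with number parameters; `i` ranges over an index set, so that `F` may vary. -/
def BDef (F : I → ℕ → Set N) (P : I → (ℕ → N) → Prop) : Prop :=
  ∃ (φ : BFormula) (p : ℕ → N), ∀ i v, φ.Holds (F i) (interleave v p) ↔ P i v

namespace BDef

variable {F : I → ℕ → Set N} {P Q : I → (ℕ → N) → Prop}

theorem congr (h : BDef F P) (e : ∀ i v, P i v ↔ Q i v) : BDef F Q := by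
  obtain ⟨φ, p, hφ⟩ := h
  exact ⟨φ, p, fun i v => (hφ i v).trans (e i v)⟩

theorem rename (h : BDef F P) {σ : ℕ → ℕ} (hσ : σ.Injective) :
    BDef F (fun i v => P i (v ∘ σ)) := by
  obtain ⟨φ, p, hφ⟩ := h
  obtain ⟨φ', h'⟩ := φ.exists_rename (N := N) hσ Function.injective_id
  exact ⟨φ', p, fun i v => (h' _ _ _).trans (hφ _ _)⟩

theorem neg (h : BDef F P) : BDef F (fun i v => ¬ P i v) := by
  obtain ⟨φ, p, hφ⟩ := h
  exact ⟨.neg φ, p, fun i v => not_congr (hφ i v)⟩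

theorem and (h : BDef F P) (h' : BDef F Q) : BDef F (fun i v => P i v ∧ Q i v) := by
  obtain ⟨φ, p, hφ⟩ := h
  obtain ⟨ψ, q, hψ⟩ := h'
  obtain ⟨φ', h1⟩ := φ.exists_rename (N := N) (τ := fun i => 2 * i) Function.injective_id
    (fun a b h => by simpa using h)
  obtain ⟨ψ', h2⟩ := ψ.exists_rename (N := N) (τ := fun i => 2 * i + 1) Function.injective_id
    (fun a b h => by simpa using h)
  refine ⟨.and φ' ψ', interleave p q, fun i v => and_congr ?_ ?_⟩
  · rw [h1, show interleave p q ∘ (fun i => 2 * i) = p from funext (interleave_even p q)]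
    exact hφ i v
  · rw [h2, show interleave p q ∘ (fun i => 2 * i + 1) = q from funext (interleave_odd p q)]
    exact hψ i v

theorem or (h : BDef F P) (h' : BDef F Q) : BDef F (fun i v => P i v ∨ Q i v) :=
  (h.neg.and h'.neg).neg.congr fun i v => by tauto

theorem ball (k : ℕ) (h : BDef F P) : BDef F (fun i v => ∀ a, a < v k → P i (push a v)) := by
  obtain ⟨φ, p, hφ⟩ := h
  obtain ⟨φ', h'⟩ := φ.exists_shift (N := N)
  refine ⟨.ball 1 (.var (2 * k)) φ', push 0 p, fun i v => ?_⟩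
  have : ∀ a, Function.update (interleave v (push 0 p)) 1 a = interleave v (push a p) := by
    refine fun a => ext_even_odd (fun i => ?_) fun i => ?_
    · rw [Function.update_of_ne (by omega), interleave_even, interleave_even]
    · rcases i with _ | i
      · rw [interleave_odd]; rfl
      · rw [Function.update_of_ne (by omega), interleave_odd, interleave_odd]; rfl
  simp only [BFormula.Holds, NTerm.val, interleave_even, this, h', hφ]

theorem bex (k : ℕ) (h : BDef F P) : BDef F (fun i v => ∃ a, a < v k ∧ P i (push a v)) :=
  (h.neg.ball k).neg.congr fun i v => by push Not; rfl

theorem var_eq (j k : ℕ) : BDef F (fun _ v => v j = v k) :=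
  ⟨.eq (.var (2 * j)) (.var (2 * k)), fun _ => 0, fun i v => by
    simp only [BFormula.Holds, NTerm.val, interleave_even]⟩

theorem var_lt (j k : ℕ) : BDef F (fun _ v => v j < v k) :=
  ⟨.lt (.var (2 * j)) (.var (2 * k)), fun _ => 0, fun i v => by
    simp only [BFormula.Holds, NTerm.val, interleave_even]⟩

theorem var_eq_add (j k l : ℕ) : BDef F (fun _ v => v j = v k + v l) :=
  ⟨.eq (.var (2 * j)) (.add (.var (2 * k)) (.var (2 * l))), fun _ => 0, fun i v => by
    simp only [BFormula.Holds, NTerm.val, interleave_even]⟩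

theorem var_eq_mul (j k l : ℕ) : BDef F (fun _ v => v j = v k * v l) :=
  ⟨.eq (.var (2 * j)) (.mul (.var (2 * k)) (.var (2 * l))), fun _ => 0, fun i v => by
    simp only [BFormula.Holds, NTerm.val, interleave_even]⟩

theorem var_eq_const (j : ℕ) (c : N) : BDef F (fun _ v => v j = c) :=
  ⟨.eq (.var (2 * j)) (.var (2 * 0 + 1)), fun _ => c, fun i v => by
    simp only [BFormula.Holds, NTerm.val, interleave_even, interleave_odd]⟩

theorem var_mem (j n : ℕ) : BDef F (fun i v => v j ∈ F i n) :=
  ⟨.mem (.var (2 * j)) n, fun _ => 0, fun i v => by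
    simp only [BFormula.Holds, NTerm.val, interleave_even]⟩

theorem const (c : Prop) : BDef F (fun _ _ => c) := by
  by_cases hc : c
  · exact (var_eq 0 0).congr fun _ _ => by simp [hc]
  · exact (var_eq 0 0).neg.congr fun _ _ => by simp [hc]

end BDef

/-! ### `Σ⁰₁` definability -/

/-- `P` is a predicate on contexts, uniformly definable from the sets `F i` by a `Σ⁰₁` formula with
number parameters. The closure properties are instances. -/
class Sg (F : I → ℕ → Set N) (P : I → (ℕ → N) → Prop) : Prop where
  out : ∃ M, BDef F M ∧ ∀ i v, P i v ↔ ∃ w, M i (push w v)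

/-- The complement of `P` is `Σ⁰₁`. -/
class Pg (F : I → ℕ → Set N) (P : I → (ℕ → N) → Prop) : Prop where
  neg : Sg F (fun i v => ¬ P i v)

/-- The function `f` on contexts has a `Σ⁰₁` graph, that is, it is computable from the sets. -/
class Fn (F : I → ℕ → Set N) (f : I → (ℕ → N) → N) : Prop where
  graph : Sg F (fun i v => v 0 = f i (tail v))

/-- The set variables of `F` stand for sets of a model of `RCA₀`. -/
class InModel (F : I → ℕ → Set N) : Prop where
  out : ∃ S, RCA0 S ∧ ∀ i n, F i n ∈ S

namespace Sg

variable {F : I → ℕ → Set N} {P Q : I → (ℕ → N) → Prop}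

theorem congr (h : Sg F P) (e : ∀ i v, Q i v ↔ P i v) : Sg F Q := by
  obtain ⟨M, hM, h⟩ := h
  exact ⟨M, hM, fun i v => (e i v).trans (h i v)⟩

theorem of_bdef (h : BDef F P) : Sg F P :=
  ⟨fun i v => P i (v ∘ Nat.succ), h.rename Nat.succ_injective, fun _ _ =>
    ⟨fun h => ⟨0, h⟩, fun ⟨_, h⟩ => h⟩⟩

/-- Renaming that fixes the innermost variable. -/
def lift (σ : ℕ → ℕ) : ℕ → ℕ
  | 0 => 0
  | i + 1 => σ i + 1

theorem lift_injective {σ : ℕ → ℕ} (hσ : σ.Injective) : (lift σ).Injective := by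
  rintro (_ | a) (_ | b) h
  · rfl
  · simp [lift] at h
  · simp [lift] at h
  · rw [@hσ a b (by simpa [lift] using h)]

theorem push_comp_lift (a : N) (v : ℕ → N) (σ : ℕ → ℕ) : push a v ∘ lift σ = push a (v ∘ σ) := by
  funext i; cases i <;> rfl

theorem rename (h : Sg F P) {σ : ℕ → ℕ} (hσ : σ.Injective) : Sg F (fun i v => P i (v ∘ σ)) := by
  obtain ⟨M, hM, h⟩ := h
  refine ⟨_, hM.rename (lift_injective hσ), fun i v => ?_⟩
  simp only [push_comp_lift, h]

theorem weaken (h : Sg F P) : Sg F (fun i v => P i (tail v)) := h.rename Nat.succ_injective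

end Sg
end Raw

section

variable {N : Type u} [RCA0Numbers N] {I : Type w} {F : I → ℕ → Set N}

theorem lt_succ_iff_le {m n : N} : m < n + 1 ↔ m ≤ n := by
  obtain ⟨S, hS⟩ := RCA0Numbers.model (N := N)
  rw [hS.lt_succ_iff, le_iff_lt_or_eq]

theorem lt_succ_self' (n : N) : n < n + 1 := lt_succ_iff_le.2 le_rfl

theorem succ_le_iff_lt {m n : N} : m + 1 ≤ n ↔ m < n := by
  rw [← not_lt, lt_succ_iff_le, not_le]

theorem not_lt_zero' (n : N) : ¬ n < 0 := not_lt.2 zero_le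

theorem exists_gt_both (a b : N) : ∃ u, a < u ∧ b < u :=
  ⟨max a b + 1, lt_succ_iff_le.2 (le_max_left _ _), lt_succ_iff_le.2 (le_max_right _ _)⟩

namespace Sg

variable {P Q : I → (ℕ → N) → Prop}

instance inst_const (c : Prop) : Sg F (fun _ _ => c) := of_bdef (BDef.const c)

instance inst_and [h : Sg F P] [h' : Sg F Q] : Sg F (fun i v => P i v ∧ Q i v) := by
  obtain ⟨M, hM, h⟩ := h
  obtain ⟨M', hM', h'⟩ := h'
  have hσ : (lift Nat.succ).Injective := lift_injective Nat.succ_injective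
  refine ⟨_, ((hM.rename hσ).bex 0).and ((hM'.rename hσ).bex 0), fun i v => ?_⟩
  simp only [push_comp_lift, push_zero, h, h']
  constructor
  · rintro ⟨⟨a, ha⟩, b, hb⟩
    obtain ⟨u, hau, hbu⟩ := exists_gt_both a b
    exact ⟨u, ⟨a, hau, ha⟩, ⟨b, hbu, hb⟩⟩
  · rintro ⟨u, ⟨a, -, ha⟩, ⟨b, -, hb⟩⟩
    exact ⟨⟨a, ha⟩, ⟨b, hb⟩⟩

instance inst_or [h : Sg F P] [h' : Sg F Q] : Sg F (fun i v => P i v ∨ Q i v) := by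
  obtain ⟨M, hM, h⟩ := h
  obtain ⟨M', hM', h'⟩ := h'
  refine ⟨_, hM.or hM', fun i v => ?_⟩
  rw [h, h', exists_or]

/-- Two existential quantifiers are contracted into a single one, for a common bound. -/
theorem ex_push (h : Sg F P) : Sg F (fun i v => ∃ a, P i (push a v)) := by
  obtain ⟨M, hM, h⟩ := h
  refine ⟨_, ((hM.rename (lift_injective (lift_injective Nat.succ_injective))).bex 1).bex 0,
    fun i v => ?_⟩
  simp only [push_comp_lift, push_zero, push_succ, h]
  constructor
  · rintro ⟨a, b, hb⟩
    obtain ⟨u, hau, hbu⟩ := exists_gt_both a b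
    exact ⟨u, a, hau, b, hbu, hb⟩
  · rintro ⟨u, a, hau, b, hbu, hb⟩
    exact ⟨a, b, hb⟩

instance inst_ex {P : I → (ℕ → N) → N → Prop} [h : Sg F (fun i v => P i (tail v) (v 0))] :
    Sg F (fun i v => ∃ a, P i v a) := ex_push h

/-- A `Σ⁰₁` predicate with the induction variable first is given by a formula in the format of the
axioms. -/
theorem exists_sigmaOne (h : Sg F P) : ∃ φ : BFormula, ∀ v, ∃ p : ℕ → N, ∀ i n,
    SigmaOne φ (F i) p n ↔ P i (push n v) := by
  obtain ⟨M, ⟨φ, p, hφ⟩, h⟩ := h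
  let ρ := Equiv.swap 1 2
  refine ⟨φ.rename ρ, fun v => ⟨interleave (push 0 (push 0 v)) p ∘ ρ, fun i n => ?_⟩⟩
  rw [h]
  refine exists_congr fun a => ?_
  rw [BFormula.holds_rename ρ.injective, ← hφ]
  have : (Function.update (Function.update (interleave (push 0 (push 0 v)) p ∘ ρ) 1 n) 0 a) ∘ ρ =
      interleave (push a (push n v)) p := by
    funext k
    rcases k with _ | _ | _ | k
    · rfl
    · rfl
    · rfl
    · have hk : ρ (k + 3) = k + 3 := Equiv.swap_apply_of_ne_of_ne (by omega) (by omega)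
      simp only [Function.comp, hk]
      rw [Function.update_of_ne (by omega), Function.update_of_ne (by omega)]
      simp only [Function.comp, hk]
      rcases Nat.even_or_odd' (k + 3) with ⟨j, hj | hj⟩
      · rw [hj, interleave_even, interleave_even]
        obtain ⟨j, rfl⟩ : ∃ j', j = j' + 2 := ⟨j - 2, by omega⟩
        rfl
      · rw [hj, interleave_odd, interleave_odd]
  simp only [this]

theorem induction_push [hF : InModel F] (h : Sg F P) (i : I) (v : ℕ → N) (h0 : P i (push 0 v))
    (hs : ∀ n, P i (push n v) → P i (push (n + 1) v)) (n : N) : P i (push n v) := by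
  obtain ⟨φ, hφ⟩ := h.exists_sigmaOne
  obtain ⟨p, hp⟩ := hφ v
  obtain ⟨S, hS, hF⟩ := hF
  simp only [← hp] at h0 hs ⊢
  exact hS.sigmaOne_induction φ (F i) p (hF i) h0 hs n

/-- `Σ⁰₁` collection. -/
theorem ball_push [InModel F] (k : ℕ) (h : Sg F P) :
    Sg F (fun i v => ∀ a, a < v k → P i (push a v)) := by
  obtain ⟨M, hM, h⟩ := h
  refine ⟨_, ((hM.rename (lift_injective (lift_injective Nat.succ_injective))).bex 1).ball (k + 1),
    fun i v => ?_⟩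
  simp only [push_comp_lift, push_zero, push_succ, h]
  have hσ : ((fun n => n + 2) : ℕ → ℕ).Injective := fun a b h => by simpa using h
  have hsg : Sg F (fun i v => ∃ u, ∀ a, a < push u v 1 → (push a (push u v) (k + 3) ≤ a ∨
      ∃ w, w < push a (push u v) 1 ∧
        M i (push w (push a (push u v)) ∘ lift (lift fun n => n + 2)))) := by
    refine ex_push (of_bdef (BDef.ball 1 (P := fun i v => v (k + 3) ≤ v 0 ∨
      ∃ w, w < v 1 ∧ M i (push w v ∘ lift (lift fun n => n + 2))) ?_))
    refine BDef.or ((BDef.var_lt 0 (k + 3)).neg.congr fun _ _ => not_lt) (BDef.bex 1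
      (P := fun i v => M i (v ∘ lift (lift fun n => n + 2))) (hM.rename (lift_injective
        (lift_injective hσ))))
  constructor
  · intro H
    have key := hsg.induction_push i v ⟨0, fun a ha => (not_lt_zero' _ ha).elim⟩ (by
      rintro n ⟨u, hu⟩
      simp only [push_zero, push_succ, push_comp_lift] at hu ⊢
      by_cases hn : n < v k
      · obtain ⟨w, hw⟩ := H n hn
        obtain ⟨u', hu', hw'⟩ := exists_gt_both u w
        refine ⟨u', fun a ha => ?_⟩
        rcases (lt_succ_iff_le.1 ha).lt_or_eq with ha | rfl
        · refine (hu a ha).imp id ?_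
          rintro ⟨w, hw, hM⟩
          exact ⟨w, hw.trans hu', hM⟩
        · exact .inr ⟨w, hw', hw⟩
      · refine ⟨u, fun a ha => ?_⟩
        rcases (lt_succ_iff_le.1 ha).lt_or_eq with ha | rfl
        · exact hu a ha
        · exact .inl (not_lt.1 hn)) (v k)
    obtain ⟨u, hu⟩ := key
    refine ⟨u, fun a ha => ?_⟩
    obtain ⟨w, hw, hM⟩ := (hu a ha).resolve_left (not_le.2 ha)
    rw [push_comp_lift, push_comp_lift] at hM
    exact ⟨w, hw, hM⟩
  · rintro ⟨u, hu⟩ a ha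
    obtain ⟨w, -, hw⟩ := hu a ha
    exact ⟨w, hw⟩

/-- Substitution of a computable function for the innermost variable. -/
theorem subst (h : Sg F P) (f : I → (ℕ → N) → N) [hf : Fn F f] :
    Sg F (fun i v => P i (push (f i v) v)) := by
  refine (ex_push (inst_and (h := hf.graph) (h' := h))).congr fun i v => ?_
  simp

/-- Substitution of a computable function for the second variable. -/
theorem subst_snd (h : Sg F P) (f : I → (ℕ → N) → N) [hf : Fn F f] :
    Sg F (fun i v => P i (push (v 0) (push (f i (tail v)) (tail v)))) := by
  have h1 : Sg F (fun i v => P i (v ∘ Equiv.swap 0 1)) := h.rename (Equiv.injective _)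
  have : Fn F (fun i v => f i (tail v)) :=
    ⟨(hf.graph.rename (σ := lift Nat.succ) (lift_injective Nat.succ_injective))⟩
  refine (h1.subst (fun i v => f i (tail v))).congr fun i v => ?_
  have : push (f i (tail v)) v ∘ Equiv.swap 0 1 = push (v 0) (push (f i (tail v)) (tail v)) := by
    funext k
    rcases k with _ | _ | k
    · rfl
    · rfl
    · have hk : Equiv.swap 0 1 (k + 2) = k + 2 :=
        Equiv.swap_apply_of_ne_of_ne (by omega) (by omega)
      simp only [Function.comp, hk]; rfl
  rw [this]

theorem subst₂ (h : Sg F P) (f g : I → (ℕ → N) → N) [hf : Fn F f] [hg : Fn F g] :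
    Sg F (fun i v => P i (push (f i v) (push (g i v) v))) :=
  (h.subst_snd g).subst f

end Sg

/-! ### Closure properties, as instances -/

section Instances

variable {P Q : I → (ℕ → N) → Prop} {f g : I → (ℕ → N) → N}

/-- `g` drops finitely many variables from the context. -/
class Proj (g : (ℕ → N) → (ℕ → N)) : Prop where
  out : ∃ k, ∀ v j, g v j = v (j + k)

instance Proj.inst_id : Proj (N := N) (fun v => v) := ⟨0, fun _ _ => rfl⟩

instance Proj.inst_tail_self : Proj (N := N) tail := ⟨1, fun _ _ => rfl⟩

instance Proj.inst_tail {g : (ℕ → N) → (ℕ → N)} [h : Proj g] : Proj (fun v => tail (g v)) := by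
  obtain ⟨k, hk⟩ := h
  exact ⟨k + 1, fun v j => by rw [tail, hk]; congr 1; omega⟩

instance Fn.inst_var {g : (ℕ → N) → (ℕ → N)} {j : ℕ} [h : Proj g] : Fn F (fun _ v => g v j) := by
  obtain ⟨k, hk⟩ := h
  exact ⟨Sg.of_bdef ((BDef.var_eq 0 (j + k + 1)).congr fun i v => by rw [hk]; rfl)⟩

instance Fn.inst_const (c : N) : Fn F (fun _ _ => c) := ⟨Sg.of_bdef (BDef.var_eq_const 0 c)⟩

theorem Fn.weaken [h : Fn F f] : Fn F (fun i v => f i (tail v)) :=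
  ⟨h.graph.rename (σ := Sg.lift Nat.succ) (Sg.lift_injective Nat.succ_injective)⟩

/-- A binary predicate of numbers that is `Σ⁰₁` in variables is so in computable functions. -/
theorem Sg.of_vars₂ {R : I → N → N → Prop} (h : Sg F (fun i v => R i (v 0) (v 1)))
    [Fn F f] [Fn F g] : Sg F (fun i v => R i (f i v) (g i v)) := h.subst₂ f g

theorem Sg.of_vars₁ {R : I → N → Prop} (h : Sg F (fun i v => R i (v 0)))
    [Fn F f] : Sg F (fun i v => R i (f i v)) := h.subst f

/-- A function of two numbers is computable if its graph is `Σ⁰₁`. -/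
theorem Fn.of_vars₂ {h : I → N → N → N} (H : Sg F (fun i v => v 0 = h i (v 1) (v 2)))
    [Fn F f] [Fn F g] : Fn F (fun i v => h i (f i v) (g i v)) := by
  have h1 : Sg F (fun i v => v 2 = h i (v 0) (v 1)) :=
    H.rename (σ := (Equiv.swap 1 2).trans (Equiv.swap 0 2)) (Equiv.injective _)
  have := Fn.weaken (F := F) (f := f)
  have := Fn.weaken (F := F) (f := g)
  exact ⟨h1.subst₂ (fun i v => f i (tail v)) (fun i v => g i (tail v))⟩

theorem Fn.of_vars₁ {h : I → N → N} (H : Sg F (fun i v => v 0 = h i (v 1)))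
    [Fn F f] : Fn F (fun i v => h i (f i v)) :=
  Fn.of_vars₂ (h := fun i a _ => h i a) (g := f) H

instance Fn.inst_add [Fn F f] [Fn F g] : Fn F (fun i v => f i v + g i v) :=
  Fn.of_vars₂ (h := fun _ a b => a + b) (Sg.of_bdef (BDef.var_eq_add 0 1 2))

instance Fn.inst_mul [Fn F f] [Fn F g] : Fn F (fun i v => f i v * g i v) :=
  Fn.of_vars₂ (h := fun _ a b => a * b) (Sg.of_bdef (BDef.var_eq_mul 0 1 2))

instance Sg.inst_eq [Fn F f] [Fn F g] : Sg F (fun i v => f i v = g i v) :=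
  Sg.of_vars₂ (R := fun _ a b => a = b) (Sg.of_bdef (BDef.var_eq 0 1))

instance Sg.inst_lt [Fn F f] [Fn F g] : Sg F (fun i v => f i v < g i v) :=
  Sg.of_vars₂ (R := fun _ a b => a < b) (Sg.of_bdef (BDef.var_lt 0 1))

instance Sg.inst_le [Fn F f] [Fn F g] : Sg F (fun i v => f i v ≤ g i v) :=
  (Sg.of_vars₂ (R := fun _ a b => ¬ b < a) (f := f) (g := g)
    (Sg.of_bdef (BDef.var_lt 1 0).neg)).congr fun _ _ => not_lt.symm

instance Pg.inst_eq [Fn F f] [Fn F g] : Pg F (fun i v => f i v = g i v) :=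
  ⟨Sg.of_vars₂ (R := fun _ a b => ¬ a = b) (Sg.of_bdef (BDef.var_eq 0 1).neg)⟩

instance Pg.inst_lt [Fn F f] [Fn F g] : Pg F (fun i v => f i v < g i v) :=
  ⟨Sg.of_vars₂ (R := fun _ a b => ¬ a < b) (Sg.of_bdef (BDef.var_lt 0 1).neg)⟩

instance Pg.inst_le [Fn F f] [Fn F g] : Pg F (fun i v => f i v ≤ g i v) :=
  ⟨Sg.inst_lt (f := g) (g := f) |>.congr fun _ _ => not_le⟩

instance Sg.inst_not [h : Pg F P] : Sg F (fun i v => ¬ P i v) := h.neg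

instance Pg.inst_not [h : Sg F P] : Pg F (fun i v => ¬ P i v) := ⟨h.congr fun _ _ => not_not⟩

instance Pg.inst_const (c : Prop) : Pg F (fun _ _ => c) := ⟨Sg.inst_const _⟩

instance Pg.inst_and [h : Pg F P] [h' : Pg F Q] : Pg F (fun i v => P i v ∧ Q i v) :=
  ⟨(Sg.inst_or (h := h.neg) (h' := h'.neg)).congr fun _ _ => not_and_or⟩

instance Pg.inst_or [h : Pg F P] [h' : Pg F Q] : Pg F (fun i v => P i v ∨ Q i v) :=
  ⟨(Sg.inst_and (h := h.neg) (h' := h'.neg)).congr fun _ _ => not_or⟩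

instance Sg.inst_imp [h : Pg F P] [h' : Sg F Q] : Sg F (fun i v => P i v → Q i v) :=
  (Sg.inst_or (h := h.neg) (h' := h')).congr fun _ _ => imp_iff_not_or

instance Pg.inst_imp [h : Sg F P] [h' : Pg F Q] : Pg F (fun i v => P i v → Q i v) :=
  ⟨(Sg.inst_and (h := h) (h' := h'.neg)).congr fun _ _ => by push Not; rfl⟩

instance Sg.inst_iff [Sg F P] [Sg F Q] [Pg F P] [Pg F Q] : Sg F (fun i v => P i v ↔ Q i v) :=
  (Sg.inst_and (P := fun i v => P i v → Q i v) (Q := fun i v => Q i v → P i v)).congr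
    fun _ _ => iff_iff_implies_and_implies

instance Pg.inst_iff [Sg F P] [Sg F Q] [Pg F P] [Pg F Q] : Pg F (fun i v => P i v ↔ Q i v) :=
  ⟨(Pg.inst_and (P := fun i v => P i v → Q i v) (Q := fun i v => Q i v → P i v)).neg.congr
    fun _ _ => not_congr iff_iff_implies_and_implies⟩

instance Pg.inst_all {P : I → (ℕ → N) → N → Prop} [h : Pg F (fun i v => P i (tail v) (v 0))] :
    Pg F (fun i v => ∀ a, P i v a) :=
  ⟨(Sg.ex_push h.neg).congr fun _ _ => by push Not; rfl⟩

instance Sg.inst_ball [InModel F] {P : I → (ℕ → N) → N → Prop} [hf : Fn F f]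
    [h : Sg F (fun i v => P i (tail v) (v 0))] : Sg F (fun i v => ∀ a, a < f i v → P i v a) := by
  have h1 : Sg F (fun i v => P i (v ∘ Nat.succ ∘ Nat.succ) (v 0)) :=
    h.rename (σ := Sg.lift Nat.succ) (Sg.lift_injective Nat.succ_injective)
  exact (h1.ball_push 0).subst f

instance Sg.inst_ball_le [InModel F] {P : I → (ℕ → N) → N → Prop} [hf : Fn F f]
    [h : Sg F (fun i v => P i (tail v) (v 0))] : Sg F (fun i v => ∀ a, a ≤ f i v → P i v a) :=
  (Sg.inst_ball (f := fun i v => f i v + 1) (P := P)).congr fun _ _ => by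
    simp only [lt_succ_iff_le]

instance Pg.inst_bex_le [InModel F] {P : I → (ℕ → N) → N → Prop} [hf : Fn F f]
    [h : Pg F (fun i v => P i (tail v) (v 0))] : Pg F (fun i v => ∃ a, a ≤ f i v ∧ P i v a) :=
  ⟨(Sg.inst_ball_le (h := h.neg)).congr fun _ _ => by push Not; rfl⟩

instance Fn.inst_ite [h : Sg F P] [h' : Pg F P] [∀ i v, Decidable (P i v)] [hf : Fn F f]
    [hg : Fn F g] : Fn F (fun i v => if P i v then f i v else g i v) := by
  have h1 := h.weaken
  have h2 := h'.neg.weaken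
  have := Fn.weaken (F := F) (f := f)
  have := Fn.weaken (F := F) (f := g)
  refine ⟨(Sg.inst_or (h := Sg.inst_and (h := h1) (h' := hf.graph))
    (h' := Sg.inst_and (h := h2) (h' := hg.graph))).congr fun i v => ?_⟩
  split_ifs with hp <;> simp [hp]

/-- Membership in the set `X` is `Σ⁰₁` in the sets `F i`. -/
class SgSet (F : I → ℕ → Set N) (X : Set N) : Prop where
  out : Sg F (fun _ v => v 0 ∈ X)

/-- Membership in the complement of the set `X` is `Σ⁰₁` in the sets `F i`. -/
class PgSet (F : I → ℕ → Set N) (X : Set N) : Prop where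
  out : Sg F (fun _ v => v 0 ∉ X)

instance Sg.inst_mem {X : Set N} [h : SgSet F X] [Fn F f] : Sg F (fun i v => f i v ∈ X) :=
  Sg.of_vars₁ (R := fun _ a => a ∈ X) h.out

instance Pg.inst_mem {X : Set N} [h : PgSet F X] [Fn F f] : Pg F (fun i v => f i v ∈ X) :=
  ⟨Sg.of_vars₁ (R := fun _ a => a ∉ X) h.out⟩

instance Sg.inst_mem_base {n : ℕ} [Fn F f] : Sg F (fun i v => f i v ∈ F i n) :=
  Sg.of_vars₁ (R := fun i a => a ∈ F i n) (Sg.of_bdef (BDef.var_mem 0 n))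

instance Pg.inst_mem_base {n : ℕ} [Fn F f] : Pg F (fun i v => f i v ∈ F i n) :=
  ⟨Sg.of_vars₁ (R := fun i a => a ∉ F i n) (Sg.of_bdef (BDef.var_mem 0 n).neg)⟩

end Instances

/-! ### Substitution into formulas -/

theorem NTerm.fn_val {f : ℕ → I → (ℕ → N) → N} (hf : ∀ k, Fn F (f k)) (t : NTerm) :
    Fn F (fun i v => t.val (fun k => f k i v)) := by
  induction t with
  | var k => exact hf k
  | zero => exact Fn.inst_const 0
  | one => exact Fn.inst_const 1
  | add s t hs ht => exact Fn.inst_add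
  | mul s t hs ht => exact Fn.inst_mul

/-- A bounded formula whose set variables stand for sets computable in the given ones, and whose
number variables stand for computable functions, defines a computable predicate. -/
theorem BFormula.sg_pg_holds [InModel F] {X : ℕ → I → (ℕ → N) → Set N}
    (hX : ∀ n, Sg F (fun i v => v 0 ∈ X n i (tail v)))
    (hX' : ∀ n, Sg F (fun i v => v 0 ∉ X n i (tail v)))
    (φ : BFormula) {f : ℕ → I → (ℕ → N) → N} (hf : ∀ k, Fn F (f k)) :
    Sg F (fun i v => φ.Holds (fun n => X n i v) (fun k => f k i v)) ∧
      Pg F (fun i v => φ.Holds (fun n => X n i v) (fun k => f k i v)) := by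
  induction φ generalizing f X with
  | eq s t =>
    have := s.fn_val hf
    have := t.fn_val hf
    exact ⟨Sg.inst_eq, Pg.inst_eq⟩
  | lt s t =>
    have := s.fn_val hf
    have := t.fn_val hf
    exact ⟨Sg.inst_lt, Pg.inst_lt⟩
  | mem t n =>
    have := t.fn_val hf
    exact ⟨(hX n).subst (fun i v => t.val (fun k => f k i v)),
      ⟨(hX' n).subst (fun i v => t.val (fun k => f k i v))⟩⟩
  | neg φ h =>
    obtain ⟨h1, h2⟩ := h hX hX' hf
    exact ⟨Sg.inst_not, Pg.inst_not⟩
  | and φ ψ h h' =>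
    obtain ⟨h1, h2⟩ := h hX hX' hf
    obtain ⟨h3, h4⟩ := h' hX hX' hf
    exact ⟨Sg.inst_and, Pg.inst_and⟩
  | ball k t φ h =>
    have ht := t.fn_val hf
    have hf' : ∀ j, Fn F (fun i v => Function.update (fun k => f k i (tail v)) k (v 0) j) := by
      intro j
      by_cases hj : j = k
      · subst hj
        simp only [Function.update_self]
        infer_instance
      · simp only [Function.update_of_ne hj]
        exact Fn.weaken
    obtain ⟨h1, h2⟩ := h (X := fun n i v => X n i (tail v))
      (fun n => (hX n).rename (Sg.lift_injective Nat.succ_injective))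
      (fun n => (hX' n).rename (Sg.lift_injective Nat.succ_injective)) hf'
    refine ⟨Sg.inst_ball (f := fun i v => t.val (fun k => f k i v)) (P := fun i v a =>
      φ.Holds (fun n => X n i v) (Function.update (fun k => f k i v) k a)), ?_⟩
    have : Pg F (fun i v => v 0 < t.val (fun k => f k i (tail v)) →
        φ.Holds (fun n => X n i (tail v)) (Function.update (fun k => f k i (tail v)) k (v 0))) := by
      have := Fn.weaken (h := ht)
      exact Pg.inst_imp
    exact Pg.inst_all (P := fun i v a => a < t.val (fun k => f k i v) →
      φ.Holds (fun n => X n i v) (Function.update (fun k => f k i v) k a))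

/-- The analogue for `Σ⁰₁` formulas. -/
theorem sg_sigmaOne [InModel F] {X : ℕ → I → (ℕ → N) → Set N}
    (hX : ∀ n, Sg F (fun i v => v 0 ∈ X n i (tail v)))
    (hX' : ∀ n, Sg F (fun i v => v 0 ∉ X n i (tail v)))
    (φ : BFormula) (p : ℕ → N) (f : I → (ℕ → N) → N) [hf : Fn F f] :
    Sg F (fun i v => SigmaOne φ (fun n => X n i v) p (f i v)) := by
  have hf' : ∀ j, Fn F (fun i v => Function.update (Function.update p 1 (f i (tail v))) 0 (v 0) j)
      := by
    intro j
    rcases j with _ | _ | j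
    · exact Fn.inst_var (g := fun v => v)
    · exact Fn.weaken
    · exact Fn.inst_const (p (j + 2))
  exact Sg.inst_ex (P := fun i v a => φ.Holds (fun n => X n i v)
    (Function.update (Function.update p 1 (f i v)) 0 a))
    (h := (φ.sg_pg_holds (X := fun n i v => X n i (tail v))
      (fun n => (hX n).rename (Sg.lift_injective Nat.succ_injective))
      (fun n => (hX' n).rename (Sg.lift_injective Nat.succ_injective)) hf').1)

end

section

variable {N : Type u} [RCA0Numbers N]

/-! ### Induction, comprehension and the least number principle -/

section Induction

variable {F : Unit → ℕ → Set N}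

theorem Sg.induction (F : Unit → ℕ → Set N) [InModel F] {P : N → Prop}
    [h : Sg F (fun _ v => P (v 0))] (h0 : P 0) (hs : ∀ n, P n → P (n + 1)) (n : N) : P n :=
  h.induction_push () (fun _ => 0) h0 hs n

theorem exists_least (F : Unit → ℕ → Set N) [InModel F] {P : N → Prop}
    [h : Pg F (fun _ v => P (v 0))] (hP : ∃ n, P n) : ∃ n, P n ∧ ∀ m, m < n → ¬ P m := by
  by_contra! H
  have : Pg F (fun _ v => P (v 0)) := h
  have h1 : Sg F (fun _ v => ∀ m, m < v 0 → ¬ P m) := by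
    have : Sg F (fun _ v => ¬ P (v 0)) := h.neg
    exact Sg.inst_ball (f := fun _ v => v 0) (P := fun _ _ m => ¬ P m)
  have key := Sg.induction F (P := fun n => ∀ m, m < n → ¬ P m)
    (fun m hm => (not_lt_zero' m hm).elim) (fun n hn m hm => by
      rcases (lt_succ_iff_le.1 hm).lt_or_eq with hm | rfl
      · exact hn m hm
      · intro hm
        obtain ⟨k, hk, hk'⟩ := H m hm
        exact hn k hk hk')
  obtain ⟨n, hn⟩ := hP
  exact key (n + 1) n (lt_succ_self' n) hn

/-- The set variables of a formula all stand for `Z`. -/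
def oneSet (Z : Set N) : Unit → ℕ → Set N := fun _ _ => Z

instance {Z : Set N} : SgSet (oneSet Z) Z := ⟨Sg.inst_mem_base (F := oneSet Z) (n := 0)⟩
instance {Z : Set N} : PgSet (oneSet Z) Z := ⟨(Pg.inst_mem_base (F := oneSet Z) (n := 0)).neg⟩

theorem InModel.oneSet {S : Set (Set N)} (hS : RCA0 S) {Z : Set N} (hZ : Z ∈ S) :
    InModel (oneSet Z) :=
  ⟨S, hS, fun _ _ => hZ⟩

/-- Set variables that stand for two given sets. -/
def pairSets (A B : Set N) : Unit → ℕ → Set N := fun _ => twoSets A B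

section

variable {A B : Set N}

instance : SgSet (pairSets A B) A := ⟨Sg.inst_mem_base (F := pairSets A B) (n := 0)⟩
instance : PgSet (pairSets A B) A := ⟨(Pg.inst_mem_base (F := pairSets A B) (n := 0)).neg⟩
instance : SgSet (pairSets A B) B := ⟨Sg.inst_mem_base (F := pairSets A B) (n := 1)⟩
instance : PgSet (pairSets A B) B := ⟨(Pg.inst_mem_base (F := pairSets A B) (n := 1)).neg⟩

theorem pairSets_mem {S : Set (Set N)} (hA : A ∈ S) (hB : B ∈ S) (n : ℕ) :
    pairSets A B () n ∈ S := by
  rcases n with _ | n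
  exacts [hA, hB]

theorem InModel.pairSets {S : Set (Set N)} (hS : RCA0 S) (hA : A ∈ S) (hB : B ∈ S) :
    InModel (pairSets A B) :=
  ⟨S, hS, fun _ => pairSets_mem hA hB⟩

end

/-- `Δ⁰₁` comprehension, for sets given by predicates of the calculus. -/
theorem comprehension {S : Set (Set N)} (hS : RCA0 S) (hF : ∀ n, F () n ∈ S) (X : Set N)
    [h : SgSet F X] [h' : PgSet F X] : X ∈ S := by
  obtain ⟨φ, hφ⟩ := h.out.exists_sigmaOne
  obtain ⟨p, hφ⟩ := hφ (fun _ => 0)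
  obtain ⟨ψ, hψ⟩ := h'.out.exists_sigmaOne
  obtain ⟨q, hψ⟩ := hψ (fun _ => 0)
  -- The two formulas share their parameters after a renaming of variables.
  let ρ (b : ℕ) : ℕ → ℕ := fun k => if k < 2 then k else 2 * k + b
  have hρ : ∀ b, (ρ b).Injective := by
    intro b x y h
    simp only [ρ] at h
    split_ifs at h <;> omega
  let r : ℕ → N := interleave p q
  have h0 : ∀ n a, Function.update (Function.update r 1 n) 0 a ∘ ρ 0 =
      Function.update (Function.update p 1 n) 0 a := by
    intro n a
    funext k
    rcases k with _ | _ | k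
    · rfl
    · rfl
    · have : ρ 0 (k + 2) = 2 * (k + 2) := rfl
      rw [Function.comp, this, Function.update_of_ne (by omega), Function.update_of_ne (by omega),
        Function.update_of_ne (by omega), Function.update_of_ne (by omega)]
      exact interleave_even p q _
  have h1 : ∀ n a, Function.update (Function.update r 1 n) 0 a ∘ ρ 1 =
      Function.update (Function.update q 1 n) 0 a := by
    intro n a
    funext k
    rcases k with _ | _ | k
    · rfl
    · rfl
    · have : ρ 1 (k + 2) = 2 * (k + 2) + 1 := rfl
      rw [Function.comp, this, Function.update_of_ne (by omega), Function.update_of_ne (by omega),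
        Function.update_of_ne (by omega), Function.update_of_ne (by omega)]
      exact interleave_odd p q _
  have hφ' : ∀ n, SigmaOne (φ.rename (ρ 0)) (F ()) r n ↔ n ∈ X := by
    intro n
    refine Iff.trans (exists_congr fun a => ?_) (hφ () n)
    rw [BFormula.holds_rename (hρ 0), h0]
  have hψ' : ∀ n, PiOne (.neg (ψ.rename (ρ 1))) (F ()) r n ↔ n ∈ X := by
    intro n
    rw [← not_iff_not]
    refine Iff.trans ?_ (hψ () n)
    simp only [PiOne, BFormula.Holds, not_forall, not_not]
    refine exists_congr fun a => ?_
    rw [BFormula.holds_rename (hρ 1), h1]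
  have := hS.deltaOne_comprehension _ _ (F ()) r hF (fun n => (hφ' n).trans (hψ' n).symm)
  convert this using 1
  ext n
  exact (hφ' n).symm

/-- Comprehension with two set parameters. -/
theorem comprehension₂ {S : Set (Set N)} (hS : RCA0 S) {A B : Set N} (hA : A ∈ S) (hB : B ∈ S)
    (X : Set N) [SgSet (pairSets A B) X] [PgSet (pairSets A B) X] : X ∈ S :=
  comprehension hS (pairSets_mem hA hB) X

/-- The one-place function `h` is computable from the sets. -/
class Comp {I : Type w} (F : I → ℕ → Set N) (h : N → N) : Prop where
  out : Fn F (fun _ v => h (v 0))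

instance Fn.inst_comp {I : Type w} {F : I → ℕ → Set N} {h : N → N} [hh : Comp F h]
    {f : I → (ℕ → N) → N} [Fn F f] : Fn F (fun i v => h (f i v)) :=
  Fn.of_vars₁ (h := fun _ => h) hh.out.graph

/-- Choice of the least witness. -/
theorem exists_choice (F : Unit → ℕ → Set N) [InModel F] {Q : N → N → Prop}
    [h : Sg F (fun _ v => Q (v 1) (v 0))] [h' : Pg F (fun _ v => Q (v 1) (v 0))]
    (hQ : ∀ x, ∃ y, Q x y) : ∃ g : N → N, Comp F g ∧ ∀ x, Q x (g x) := by
  have h2 : ∀ x, Pg F (fun _ v => Q x (v 0)) := fun x => ⟨h'.neg.subst_snd (fun _ _ => x)⟩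
  choose g hg hg' using fun x => exists_least F (P := Q x) (hQ x)
  refine ⟨g, ⟨⟨?_⟩⟩, hg⟩
  have h3 : Sg F (fun _ v => ¬ Q (v 2) (v 0)) := h'.neg.rename (σ := Sg.lift Nat.succ)
    (Sg.lift_injective Nat.succ_injective)
  have h4 : Sg F (fun _ v => ∀ z, z < v 0 → ¬ Q (v 1) z) :=
    Sg.inst_ball (f := fun _ v => v 0) (P := fun _ v z => ¬ Q (v 1) z) (h := h3)
  refine (Sg.inst_and (h := h) (h' := h4)).congr fun _ v => ⟨?_, ?_⟩
  · intro e
    change v 0 = g (v 1) at e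
    rw [e]
    exact ⟨hg _, hg' _⟩
  · rintro ⟨h5, h6⟩
    rcases lt_trichotomy (v 0) (g (v 1)) with hl | hl | hl
    · exact (hg' _ _ hl h5).elim
    · exact hl
    · exact (h6 _ hl (hg _)).elim

end Induction

/-! ### Pairs -/

/-- Some set of a model, as the value of all set variables: arithmetic needs no set variables. -/
noncomputable def someSets (N : Type u) [RCA0Numbers N] : Unit → ℕ → Set N :=
  fun _ _ => (RCA0Numbers.model (N := N)).choose_spec.sets_nonempty.choose

instance : InModel (someSets N) :=
  ⟨_, (RCA0Numbers.model (N := N)).choose_spec, fun _ _ =>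
    (RCA0Numbers.model (N := N)).choose_spec.sets_nonempty.choose_spec⟩

theorem exists_sqrt (c : N) : ∃ s, s * s ≤ c ∧ c < (s + 1) * (s + 1) := by
  refine Sg.induction (someSets N) (P := fun c => ∃ s, s * s ≤ c ∧ c < (s + 1) * (s + 1))
    ⟨0, by simp⟩ ?_ c
  rintro c ⟨s, h1, h2⟩
  rcases (succ_le_iff_lt.2 h2).lt_or_eq with h | h
  · exact ⟨s, h1.trans (lt_succ_self' c).le, h⟩
  · refine ⟨s + 1, h.ge, ?_⟩
    rw [h]
    exact mul_lt_mul'' (lt_succ_self' _) (lt_succ_self' _) zero_le zero_le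

theorem sqrt_unique {c s t : N} (h1 : s * s ≤ c) (h2 : c < (t + 1) * (t + 1)) : s ≤ t := by
  by_contra! h
  exact absurd (mul_le_mul' (succ_le_iff_lt.2 h) (succ_le_iff_lt.2 h))
    (not_le.2 (h1.trans_lt h2))

theorem pair_bounds (a b : N) :
    max a b * max a b ≤ pair a b ∧ pair a b < (max a b + 1) * (max a b + 1) := by
  unfold pair
  split_ifs with h
  · rw [max_eq_right h.le]
    refine ⟨le_self_add, lt_of_lt_of_le (add_lt_add_right h _) ?_⟩
    rw [show (b + 1) * (b + 1) = b * b + b + (b + 1) by ring]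
    exact le_self_add
  · rw [not_lt] at h
    rw [max_eq_left h]
    refine ⟨by rw [add_assoc]; exact le_self_add, ?_⟩
    rw [show (a + 1) * (a + 1) = a * a + a + a + 1 by ring, lt_succ_iff_le]
    exact add_le_add_right h _

theorem pair_inj {a b c d : N} (h : pair a b = pair c d) : a = c ∧ b = d := by
  have e : max a b = max c d := by
    have h1 := pair_bounds a b
    have h2 := pair_bounds c d
    rw [h] at h1
    exact le_antisymm (sqrt_unique h1.1 h2.2) (sqrt_unique h2.1 h1.2)
  unfold pair at h
  split_ifs at h with h1 h2 h2
  · rw [max_eq_right h1.le, max_eq_right h2.le] at e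
    subst e
    exact ⟨add_left_cancel h, rfl⟩
  · rw [not_lt] at h2
    rw [max_eq_right h1.le, max_eq_left h2] at e
    subst e
    rw [add_assoc] at h
    have := add_left_cancel h
    exact absurd h1 (not_lt.2 (this ▸ le_self_add))
  · rw [not_lt] at h1
    rw [max_eq_left h1, max_eq_right h2.le] at e
    subst e
    rw [add_assoc] at h
    have := add_left_cancel h
    exact absurd h2 (not_lt.2 (this ▸ le_self_add))
  · rw [not_lt] at h1 h2
    rw [max_eq_left h1, max_eq_left h2] at e
    subst e
    exact ⟨rfl, add_left_cancel h⟩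

theorem exists_pair (c : N) : ∃ a b, c = pair a b := by
  obtain ⟨s, h1, h2⟩ := exists_sqrt c
  obtain ⟨d, rfl⟩ := exists_add_of_le h1
  rcases lt_or_ge d s with h | h
  · exact ⟨d, s, by simp [pair, h]⟩
  · obtain ⟨e, rfl⟩ := exists_add_of_le h
    refine ⟨s, e, ?_⟩
    have : e ≤ s := by
      rw [show (s + 1) * (s + 1) = (s * s + s + s) + 1 by ring, lt_succ_iff_le,
        ← add_assoc] at h2
      exact le_of_add_le_add_left h2
    simp [pair, not_lt.2 this, add_assoc]

/-- The first component of a pair. -/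
noncomputable def fst (c : N) : N := (exists_pair c).choose

/-- The second component of a pair. -/
noncomputable def snd (c : N) : N := (exists_pair c).choose_spec.choose

@[simp] theorem pair_fst_snd (c : N) : pair (fst c) (snd c) = c :=
  (exists_pair c).choose_spec.choose_spec.symm

@[simp] theorem fst_pair (a b : N) : fst (pair a b) = a := (pair_inj (pair_fst_snd _)).1

@[simp] theorem snd_pair (a b : N) : snd (pair a b) = b := (pair_inj (pair_fst_snd _)).2

theorem pair_zero_lt_pair_one (a : N) : pair a 0 < pair a 1 := by
  unfold pair
  rw [if_neg (not_lt_zero' a)]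
  rcases (zero_le (a := a)).eq_or_lt with rfl | h
  · simp
  · rw [if_neg (not_lt.2 (by simpa using succ_le_iff_lt.2 h))]
    exact add_lt_add_right zero_lt_one _

section

variable {I : Type w} {F : I → ℕ → Set N} {f g : I → (ℕ → N) → N}

instance Fn.inst_pair [Fn F f] [Fn F g] : Fn F (fun i v => pair (f i v) (g i v)) :=
  Fn.of_vars₂ (h := fun _ => pair) (Sg.congr (P := fun _ v =>
    (v 1 < v 2 ∧ v 0 = v 2 * v 2 + v 1) ∨ (¬ v 1 < v 2 ∧ v 0 = v 1 * v 1 + v 1 + v 2))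
    inferInstance fun _ v => by unfold pair; split_ifs with h <;> simp [h])

instance Fn.inst_fst [Fn F f] : Fn F (fun i v => fst (f i v)) := by
  refine Fn.of_vars₁ (h := fun _ => fst) (Sg.congr (P := fun _ v => ∃ b, v 1 = pair (v 0) b)
    inferInstance fun _ v => ⟨fun h => ⟨snd (v 1), by rw [h, pair_fst_snd]⟩, ?_⟩)
  rintro ⟨b, h⟩
  rw [h, fst_pair]

instance Fn.inst_snd [Fn F f] : Fn F (fun i v => snd (f i v)) := by
  refine Fn.of_vars₁ (h := fun _ => snd) (Sg.congr (P := fun _ v => ∃ b, v 1 = pair b (v 0))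
    inferInstance fun _ v => ⟨fun h => ⟨fst (v 1), by rw [h, pair_fst_snd]⟩, ?_⟩)
  rintro ⟨b, h⟩
  rw [h, snd_pair]

instance Sg.inst_rel {P : Set N} [SgSet F P] [Fn F f] [Fn F g] :
    Sg F (fun i v => rel P (f i v) (g i v)) := by
  unfold rel; infer_instance

instance Pg.inst_rel {P : Set N} [PgSet F P] [Fn F f] [Fn F g] :
    Pg F (fun i v => rel P (f i v) (g i v)) := by
  unfold rel; infer_instance

end

end

section

variable {N : Type u} [RCA0Numbers N]

/-! ### Finite sequences -/

theorem exists_div (a : N) {m : N} (hm : 0 < m) : ∃ q r, a = q * m + r ∧ r < m := by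
  refine Sg.induction (someSets N) (P := fun a => ∃ q r, a = q * m + r ∧ r < m)
    ⟨0, 0, by simp, hm⟩ ?_ a
  rintro a ⟨q, r, rfl, hr⟩
  rcases (succ_le_iff_lt.2 hr).lt_or_eq with h | h
  · exact ⟨q, r + 1, by ring, h⟩
  · exact ⟨q + 1, 0, by rw [← h]; ring, hm⟩

theorem rem_unique {m q r q' r' : N} (h : q * m + r = q' * m + r') (hr : r < m) (hr' : r' < m) :
    r = r' := by
  have key : ∀ {q r q' r' : N}, q * m + r = q' * m + r' → r < m → q' ≤ q := by
    intro q r q' r' h hr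
    by_contra! hq
    have h1 : q * m + m ≤ q' * m := by
      calc q * m + m = (q + 1) * m := by ring
        _ ≤ q' * m := mul_le_mul' (succ_le_iff_lt.2 hq) le_rfl
    have h2 : q * m + r < q' * m := (add_lt_add_right hr _).trans_le h1
    rw [h] at h2
    exact absurd h2 (not_lt.2 le_self_add)
  have := le_antisymm (key h.symm hr') (key h hr)
  subst this
  exact add_left_cancel h

theorem modulus_pos (i b : N) : 0 < 1 + (i + 1) * b := zero_lt_one.trans_le le_self_add

theorem exists_entry (c i : N) : ∃ x, x < 1 + (i + 1) * snd (snd c) ∧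
    ∃ q, fst (snd c) = q * (1 + (i + 1) * snd (snd c)) + x := by
  obtain ⟨q, r, h, hr⟩ := exists_div (fst (snd c)) (modulus_pos i (snd (snd c)))
  exact ⟨r, hr, q, h⟩

/-- The length of the finite sequence coded by `c`. -/
noncomputable def len (c : N) : N := fst c

/-- The `i`-th entry of the finite sequence coded by `c`; it is also defined, but without meaning,
for `i` beyond the length. -/
noncomputable def ent (c i : N) : N := (exists_entry c i).choose

theorem ent_spec (c i : N) : ent c i < 1 + (i + 1) * snd (snd c) ∧
    ∃ q, fst (snd c) = q * (1 + (i + 1) * snd (snd c)) + ent c i := (exists_entry c i).choose_spec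

theorem eq_ent_iff {c i x : N} : x = ent c i ↔ x < 1 + (i + 1) * snd (snd c) ∧
    ∃ q, fst (snd c) = q * (1 + (i + 1) * snd (snd c)) + x := by
  constructor
  · rintro rfl
    exact ent_spec c i
  · rintro ⟨h, q, hq⟩
    obtain ⟨h', q', hq'⟩ := ent_spec c i
    exact rem_unique (hq.symm.trans hq') h h'

theorem seqLen_iff {c l : N} : SeqLen c l ↔ l = len c := by
  constructor
  · rintro ⟨a, b, rfl⟩
    simp [len]
  · rintro rfl
    exact ⟨fst (snd c), snd (snd c), by simp [len]⟩

theorem seqEntry_iff {c i x : N} : SeqEntry c i x ↔ i < len c ∧ x = ent c i := by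
  rw [eq_ent_iff]
  constructor
  · rintro ⟨l, a, b, rfl, h1, h2, h3⟩
    simpa [len] using ⟨h1, h2, h3⟩
  · rintro ⟨h1, h2, h3⟩
    exact ⟨fst c, fst (snd c), snd (snd c), by simp, h1, h2, h3⟩

theorem initSeg_iff {d c : N} :
    InitSeg d c ↔ len d ≤ len c ∧ ∀ i, i < len d → ent d i = ent c i := by
  unfold InitSeg
  simp only [seqLen_iff, seqEntry_iff, ← le_iff_lt_or_eq]
  constructor
  · rintro ⟨k, l, rfl, rfl, h, h'⟩
    exact ⟨h, fun i hi => ((h' i hi (ent d i)).1 ⟨hi, rfl⟩).2⟩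
  · rintro ⟨h, h'⟩
    exact ⟨_, _, rfl, rfl, h, fun i hi x => by simp [hi, hi.trans_le h, h' i hi]⟩

section

variable {I : Type w} {F : I → ℕ → Set N} {f g : I → (ℕ → N) → N}

instance Fn.inst_len [Fn F f] : Fn F (fun i v => len (f i v)) := by
  unfold len; infer_instance

instance Fn.inst_ent [Fn F f] [Fn F g] : Fn F (fun i v => ent (f i v) (g i v)) :=
  Fn.of_vars₂ (h := fun _ => ent) (Sg.congr (P := fun _ v =>
    v 0 < 1 + (v 2 + 1) * snd (snd (v 1)) ∧
    ∃ q, fst (snd (v 1)) = q * (1 + (v 2 + 1) * snd (snd (v 1))) + v 0) inferInstance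
    fun _ _ => eq_ent_iff)

end

/-- The moduli of the beta function are pairwise coprime, in the form of Bézout's identity; `j - k`
is `d`, and divides `b`. -/
theorem moduli_coprime {b k j d c : N} (hj : j = k + d) (hb : b = d * c)
    (hb0 : 0 < b) : ∃ u w, u * (1 + (k + 1) * b) = w * (1 + (j + 1) * b) + 1 := by
  obtain ⟨e, he⟩ : ∃ e, (j + 1) * b = e + 1 := by
    obtain ⟨e, he⟩ := exists_add_of_le (succ_le_iff_lt.2
      (mul_pos (lt_of_le_of_lt zero_le (lt_succ_self' j)) hb0))
    exact ⟨e, by rw [he]; ring⟩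
  -- With `E = (j + 1) b`, that is `-1` modulo the `j`-th modulus, `u = c (j + 1)² E` is an inverse
  -- of the `k`-th modulus.
  refine ⟨c * (j + 1) * (j + 1) * ((j + 1) * b),
    ((j + 1) * b) * c * (k + 1) * (j + 1) + e, ?_⟩
  have h1 : (((j + 1) * b) * c * (k + 1) * (j + 1) + e) * (1 + (j + 1) * b) + 1 =
      ((j + 1) * b) * c * (k + 1) * (j + 1) * (1 + (j + 1) * b) +
        ((j + 1) * b) * ((j + 1) * b) := by
    rw [he]; ring
  rw [h1, hb, hj]
  ring

/-- Gödel's beta function lemma: the values of a computable function at the numbers below `n` are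
the entries of a coded sequence. -/
theorem exists_seq (F : Unit → ℕ → Set N) [InModel F] (f : N → N) [Comp F f] (n : N) :
    ∃ c, len c = n ∧ ∀ i, i < n → ent c i = f i := by
  obtain ⟨B, hB⟩ : ∃ B, ∀ i, i < n → f i < B := by
    refine Sg.induction F (P := fun n => ∃ B, ∀ i, i < n → f i < B)
      ⟨0, fun i hi => (not_lt_zero' i hi).elim⟩ ?_ n
    rintro n ⟨B, hB⟩
    obtain ⟨u, hu, hu'⟩ := exists_gt_both B (f n)
    refine ⟨u, fun i hi => ?_⟩
    rcases (lt_succ_iff_le.1 hi).lt_or_eq with hi | rfl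
    · exact (hB i hi).trans hu
    · exact hu'
  obtain ⟨b, hBb, hb0, hb⟩ : ∃ b, B ≤ b ∧ 0 < b ∧ ∀ d, d ≤ n → 0 < d → ∃ c, b = d * c := by
    refine Sg.induction F (P := fun n => ∃ b, B ≤ b ∧ 0 < b ∧ ∀ d, d ≤ n → 0 < d → ∃ c, b = d * c)
      ⟨B + 1, (lt_succ_self' B).le, zero_le.trans_lt (lt_succ_self' B), fun d hd hd' =>
        (not_lt.2 hd hd').elim⟩ ?_ n
    rintro n ⟨b, h1, h2, h3⟩
    refine ⟨b * (n + 1), h1.trans ?_, mul_pos h2 (zero_le.trans_lt (lt_succ_self' n)),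
      fun d hd hd0 => ?_⟩
    · rw [mul_add, mul_one]; exact le_add_self
    · rcases hd.lt_or_eq with hd | rfl
      · obtain ⟨c, rfl⟩ := h3 d (lt_succ_iff_le.1 hd) hd0
        exact ⟨c * (n + 1), by ring⟩
      · exact ⟨b, mul_comm _ _⟩
  have key : ∀ k, k ≤ n → ∃ a P, (∀ i, i < k → (∃ q, a = q * (1 + (i + 1) * b) + f i) ∧
      ∃ q, P = q * (1 + (i + 1) * b)) ∧
      ∀ j, j < n → k ≤ j → ∃ u w, u * P = w * (1 + (j + 1) * b) + 1 := by
    refine Sg.induction F (P := fun k => k ≤ n → ∃ a P, (∀ i, i < k →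
      (∃ q, a = q * (1 + (i + 1) * b) + f i) ∧ ∃ q, P = q * (1 + (i + 1) * b)) ∧
      ∀ j, j < n → k ≤ j → ∃ u w, u * P = w * (1 + (j + 1) * b) + 1) ?_ ?_
    · exact fun _ => ⟨0, 1, fun i hi => (not_lt_zero' i hi).elim, fun j _ _ => ⟨1, 0, by simp⟩⟩
    · intro k ih hk
      have hk := succ_le_iff_lt.1 hk
      obtain ⟨a, P, h1, h2⟩ := ih hk.le
      obtain ⟨u, w, huw⟩ := h2 k hk le_rfl
      refine ⟨a + u * P * (f k + (k + 1) * b * a), P * (1 + (k + 1) * b), fun i hi => ?_,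
        fun j hj hkj => ?_⟩
      · rcases (lt_succ_iff_le.1 hi).lt_or_eq with hi | rfl
        · obtain ⟨⟨q, hq⟩, r, hr⟩ := h1 i hi
          refine ⟨⟨q + u * r * (f k + (k + 1) * b * a), ?_⟩, r * (1 + (k + 1) * b), ?_⟩
          · rw [hr]
            nth_rewrite 1 [hq]
            ring
          · rw [hr]; ring
        · refine ⟨⟨a + w * (f i + (i + 1) * b * a), ?_⟩, P, rfl⟩
          rw [huw]; ring
      · obtain ⟨d, rfl⟩ := exists_add_of_le hkj
        obtain ⟨c, hc⟩ := hb (1 + d) (le_trans (by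
          rw [show k + 1 + d = k + (1 + d) by ring]; exact le_add_self) hj.le)
          (zero_lt_one.trans_le le_self_add)
        obtain ⟨u', w', h'⟩ := moduli_coprime (show k + 1 + d = k + (1 + d) by ring) hc hb0
        obtain ⟨u2, w2, h2⟩ := h2 (k + 1 + d) hj ((lt_succ_self' k).le.trans hkj)
        refine ⟨u2 * u', w2 * w' * (1 + (k + 1 + d + 1) * b) + w2 + w', ?_⟩
        calc u2 * u' * (P * (1 + (k + 1) * b)) = (u2 * P) * (u' * (1 + (k + 1) * b)) := by ring
          _ = _ := by rw [h2, h']; ring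
  obtain ⟨a, P, h, -⟩ := key n le_rfl
  refine ⟨pair n (pair a b), by simp [len], fun i hi => (eq_ent_iff.2 ⟨?_, ?_⟩).symm⟩
  · simp only [snd_pair]
    refine ((hB i hi).trans_le hBb).trans_le ?_
    rw [add_mul, one_mul]
    exact (le_add_self (a := b) (b := i * b)).trans le_add_self
  · simpa using (h i hi).1

end

section

variable {N : Type u} [RCA0Numbers N]

/-! ### Infinite sequences, trees and paths -/

/-- The graph of a function, which represents it as an infinite sequence. -/
def graph (h : N → N) : Set N := {z | snd z = h (fst z)}

@[simp] theorem pair_mem_graph {h : N → N} {n x : N} : pair n x ∈ graph h ↔ x = h n := by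
  simp [graph]

section

variable {I : Type w} {F : I → ℕ → Set N} {h : N → N}

instance [Comp F h] : SgSet F (graph h) :=
  ⟨inferInstanceAs (Sg F (fun _ v => snd (v 0) = h (fst (v 0))))⟩

instance [Comp F h] : PgSet F (graph h) :=
  ⟨inferInstanceAs (Sg F (fun _ v => ¬ snd (v 0) = h (fst (v 0))))⟩

theorem Comp.of_sgSet [SgSet F (graph h)] : Comp F h :=
  ⟨⟨Sg.congr (P := fun _ v => pair (v 1) (v 0) ∈ graph h) inferInstance fun _ _ =>
    pair_mem_graph.symm⟩⟩

end

section

variable {S : Set (Set N)} {T P : Set N}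

theorem isInfSeq_iff {X : Set N} : IsInfSeq S X ↔ ∃ h, X = graph h ∧ graph h ∈ S := by
  constructor
  · rintro ⟨h1, h2⟩
    choose h hh hu using h2
    have : X = graph h := by
      ext z
      rw [← pair_fst_snd z, pair_mem_graph]
      exact ⟨fun hz => hu _ _ hz, fun e => e ▸ hh _⟩
    exact ⟨h, this, this ▸ h1⟩
  · rintro ⟨h, rfl, hS⟩
    exact ⟨hS, fun n => ⟨h n, by simp, fun y hy => by simpa using hy⟩⟩

theorem codesInit_graph {h : N → N} {n c : N} :
    CodesInit (graph h) n c ↔ len c = n ∧ ∀ i, i < n → ent c i = h i := by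
  unfold CodesInit
  simp only [seqLen_iff, seqEntry_iff, pair_mem_graph]
  constructor
  · rintro ⟨rfl, h2⟩
    exact ⟨rfl, fun i hi => ((h2 i hi _).1 ⟨hi, rfl⟩)⟩
  · rintro ⟨rfl, h2⟩
    exact ⟨rfl, fun i hi x => by simp [hi, h2 i hi]⟩

theorem isPath_graph {h : N → N} : IsPath S T (graph h) ↔
    graph h ∈ S ∧ ∀ n, ∃ c, c ∈ T ∧ len c = n ∧ ∀ i, i < n → ent c i = h i := by
  unfold IsPath
  simp only [codesInit_graph, isInfSeq_iff]
  refine and_congr ⟨?_, fun hh => ⟨h, rfl, hh⟩⟩ Iff.rfl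
  rintro ⟨h', e, hh⟩
  rwa [e]

theorem IsPath.exists_graph {X : Set N} (h : IsPath S T X) : ∃ f, X = graph f :=
  (isInfSeq_iff.1 h.1).imp fun _ h => h.1

/-- All codes of all initial segments of a path are in the tree. -/
theorem IsPath.mem_of_eq {h : N → N} (hp : IsPath S T (graph h)) (hT : IsTree T) {c : N}
    (hc : ∀ i, i < len c → ent c i = h i) : c ∈ T := by
  obtain ⟨d, hd, hl, he⟩ := (isPath_graph.1 hp).2 (len c)
  exact hT d hd c (initSeg_iff.2 ⟨hl.ge, fun i hi => (hc i hi).trans (he i hi).symm⟩)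

theorem lexBelow_graph {r : N → N → Prop} {h' h : N → N} :
    LexBelow r (graph h') (graph h) ↔ ∃ k, r (h' k) (h k) ∧ ∀ i, i < k → h' i = h i := by
  unfold LexBelow
  simp only [pair_mem_graph]
  constructor
  · rintro ⟨k, x, y, rfl, rfl, hr, he⟩
    exact ⟨k, hr, fun i hi => (he i hi _).1 rfl⟩
  · rintro ⟨k, hr, he⟩
    exact ⟨k, _, _, rfl, rfl, hr, fun i hi z => by rw [he i hi]⟩

theorem WellFoundedIn.not_descending (hP : WellFoundedIn S P) {h : N → N} (hh : graph h ∈ S)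
    (hd : ∀ i, rel P (h (i + 1)) (h i)) : False :=
  hP ⟨graph h, isInfSeq_iff.2 ⟨h, rfl, hh⟩, fun i x y hx hy => by
    rw [pair_mem_graph] at hx hy
    rw [hx, hy]
    exact hd i⟩

/-- A function computable from sets of the model is in the model. -/
theorem graph_mem {F : Unit → ℕ → Set N} (hS : RCA0 S) (hF : ∀ n, F () n ∈ S) {h : N → N}
    [Comp F h] : graph h ∈ S := comprehension hS hF _

end

/-- Primitive recursion: iteration of a computable function. -/
theorem exists_iterate (F : Unit → ℕ → Set N) [InModel F] (g : N → N) [Comp F g] (a : N) :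
    ∃ h : N → N, Comp F h ∧ h 0 = a ∧ ∀ n, h (n + 1) = g (h n) := by
  have hex : ∀ n, ∃ c, ent c 0 = a ∧ ∀ i, i < n → ent c (i + 1) = g (ent c i) := by
    refine Sg.induction F (P := fun n => ∃ c, ent c 0 = a ∧
      ∀ i, i < n → ent c (i + 1) = g (ent c i)) ?_ ?_
    · have : Comp F (fun _ => a) := ⟨inferInstance⟩
      obtain ⟨c, -, hc⟩ := exists_seq F (fun _ => a) 1
      exact ⟨c, hc 0 zero_lt_one, fun i hi => (not_lt_zero' i hi).elim⟩
    · rintro n ⟨c, h0, hs⟩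
      have : Comp F (fun i => if i < n + 1 then ent c i else g (ent c n)) := ⟨inferInstance⟩
      obtain ⟨d, -, hd⟩ := exists_seq F (fun i => if i < n + 1 then ent c i else g (ent c n))
        (n + 1 + 1)
      refine ⟨d, ?_, fun i hi => ?_⟩
      · have h1 : (0 : N) < n + 1 := zero_le.trans_lt (lt_succ_self' n)
        rw [hd 0 (h1.trans (lt_succ_self' _)), if_pos h1, h0]
      · rw [hd _ (lt_succ_iff_le.2 (succ_le_iff_lt.2 hi)), hd i (hi.trans (lt_succ_self' _)),
          if_pos hi]
        rcases (lt_succ_iff_le.1 hi).lt_or_eq with hi | rfl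
        · rw [if_pos (lt_succ_iff_le.2 (succ_le_iff_lt.2 hi)), hs i hi]
        · rw [if_neg (lt_irrefl _)]
  choose c hc0 hcs using hex
  have huniq : ∀ {n d e : N}, (ent d 0 = a ∧ ∀ i, i < n → ent d (i + 1) = g (ent d i)) →
      (ent e 0 = a ∧ ∀ i, i < n → ent e (i + 1) = g (ent e i)) → ∀ m, m ≤ n →
      ent d m = ent e m := by
    rintro n d e ⟨hd0, hd⟩ ⟨he0, he⟩
    refine Sg.induction F (P := fun m => m ≤ n → ent d m = ent e m) (fun _ => hd0.trans he0.symm) ?_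
    intro m ih hm
    have hm := succ_le_iff_lt.1 hm
    rw [hd m hm, he m hm, ih hm.le]
  refine ⟨fun n => ent (c n) n, ⟨⟨Sg.congr (P := fun _ v => ∃ d, ent d 0 = a ∧
    (∀ i, i < v 1 → ent d (i + 1) = g (ent d i)) ∧ v 0 = ent d (v 1)) inferInstance
    fun _ v => ?_⟩⟩, hc0 0, fun n => ?_⟩
  · constructor
    · intro e
      exact ⟨c (v 1), hc0 _, hcs _, e⟩
    · rintro ⟨d, h0, h1, h2⟩
      rw [h2]
      exact huniq ⟨h0, h1⟩ ⟨hc0 _, hcs _⟩ _ le_rfl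
  · change ent (c (n + 1)) (n + 1) = g (ent (c n) n)
    rw [hcs (n + 1) n (lt_succ_self' n), huniq (n := n) ⟨hc0 _, fun i hi =>
      hcs (n + 1) i (hi.trans (lt_succ_self' n))⟩ ⟨hc0 n, hcs n⟩ n le_rfl]

/-- A nonempty set of the model on which every pair has another with an `R`-smaller second
component contradicts the well-foundedness of `R`. -/
theorem WellFoundedIn.eq_empty {S : Set (Set N)} (hS : RCA0 S) {R D : Set N} (hR : R ∈ S)
    (hwf : WellFoundedIn S R) (hD : D ∈ S)
    (h : ∀ z, z ∈ D → ∃ z', z' ∈ D ∧ rel R (snd z') (snd z)) : D = ∅ := by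
  by_contra hne
  obtain ⟨z, hz⟩ := Set.nonempty_iff_ne_empty.2 hne
  let F := pairSets R D
  have hF : InModel F := InModel.pairSets hS hR hD
  have hFS : ∀ n, F () n ∈ S := pairSets_mem hR hD
  obtain ⟨g, hg, hQ⟩ := exists_choice F
    (Q := fun z z' => z ∈ D → z' ∈ D ∧ rel R (snd z') (snd z)) (fun z => by
      by_cases hz : z ∈ D
      · exact (h z hz).imp fun _ hz' _ => hz'
      · exact ⟨0, fun hz' => (hz hz').elim⟩)
  obtain ⟨f, hf, h0, hs⟩ := exists_iterate F g z
  have hfD : ∀ n, f n ∈ D := Sg.induction F (P := fun n => f n ∈ D) (h0 ▸ hz)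
    fun n hn => by rw [hs]; exact (hQ _ hn).1
  have : Comp F (fun n => snd (f n)) := ⟨inferInstance⟩
  refine hwf.not_descending (graph_mem hS hFS (h := fun n => snd (f n))) fun i => ?_
  rw [hs]
  exact (hQ _ (hfD i)).2

end

section

variable {N : Type u} [RCA0Numbers N]

/-! ### The tree of descending guesses -/

/-- The finite sequence guessed so far by the entry `y` of a path through `guessTree`. -/
noncomputable def guess (y : N) : N := fst (fst y)

/-- The bit of the oracle recorded by the entry `y` of a path through `guessTree`. -/
noncomputable def recorded (y : N) : N := snd (fst y)

/-- This is `1` if the last entry of `guess y` is final, and `0` if it is about to be replaced by a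
smaller one. -/
noncomputable def final (y : N) : N := snd y

/-- The condition on the `i`-th entry of a path through `guessTree T P`. -/
def GuessAt (T : Set N) (i y : N) : Prop :=
  (guess y ∈ T ∧ 0 < len (guess y) ∧ (i = 0 → len (guess y) = 1)) ∧
    ((recorded y = 1 ∧ i ∈ T) ∨ (recorded y = 0 ∧ i ∉ T)) ∧ (final y = 0 ∨ final y = 1)

/-- The condition on an entry `y` of a path through `guessTree T P` and on the guess `c` in the next
entry: if `y` is final then `c` extends the guess in `y` by one entry, otherwise `c` differs from it
in the last entry, which is `P`-smaller. -/
def GuessStep (P : Set N) (y c : N) : Prop :=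
  (final y = 1 ∧ len c = len (guess y) + 1 ∧ ∀ j, j < len (guess y) → ent c j = ent (guess y) j) ∨
  (final y = 0 ∧ len c = len (guess y) ∧ ∀ j, j < len (guess y) →
    (j + 1 < len (guess y) → ent c j = ent (guess y) j) ∧
    (j + 1 = len (guess y) → rel P (ent c j) (ent (guess y) j)))

/-- The tree whose paths compute a path through `T` together with, for each entry of it, a
`P`-descending sequence of guesses that ends in this entry. A guess that is not final is to the left
of the same guess as a final one. -/
def guessTree (T P : Set N) : Set N :=
  {c | ∀ i, i < len c → GuessAt T i (ent c i) ∧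
    (i + 1 < len c → GuessStep P (ent c i) (guess (ent c (i + 1))))}

section

variable {I : Type w} {F : I → ℕ → Set N} {f g : I → (ℕ → N) → N} {T P : Set N}

instance [Fn F f] : Fn F (fun i v => guess (f i v)) := by unfold guess; infer_instance
instance [Fn F f] : Fn F (fun i v => recorded (f i v)) := by unfold recorded; infer_instance
instance [Fn F f] : Fn F (fun i v => final (f i v)) := by unfold final; infer_instance

instance [SgSet F T] [PgSet F T] [Fn F f] [Fn F g] : Sg F (fun i v => GuessAt T (f i v) (g i v)) :=
  by unfold GuessAt; infer_instance

instance [SgSet F T] [PgSet F T] [Fn F f] [Fn F g] : Pg F (fun i v => GuessAt T (f i v) (g i v)) :=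
  by unfold GuessAt; infer_instance

instance [InModel F] [SgSet F P] [Fn F f] [Fn F g] :
    Sg F (fun i v => GuessStep P (f i v) (g i v)) := by
  refine Sg.of_vars₂ (R := fun _ => GuessStep P) ?_
  unfold GuessStep; infer_instance

instance [InModel F] [PgSet F P] [Fn F f] [Fn F g] :
    Pg F (fun i v => GuessStep P (f i v) (g i v)) := by
  have : Pg F (fun _ v => GuessStep P (v 0) (v 1)) := by unfold GuessStep; infer_instance
  exact ⟨Sg.of_vars₂ (R := fun _ a b => ¬ GuessStep P a b) this.neg⟩

instance [InModel F] [SgSet F T] [PgSet F T] [SgSet F P] : SgSet F (guessTree T P) :=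
  ⟨(inferInstance : Sg F (fun _ v => ∀ i, i < len (v 0) → GuessAt T i (ent (v 0) i) ∧
    (i + 1 < len (v 0) → GuessStep P (ent (v 0) i) (guess (ent (v 0) (i + 1))))))⟩

instance [InModel F] [SgSet F T] [PgSet F T] [PgSet F P] : PgSet F (guessTree T P) :=
  ⟨(inferInstance : Pg F (fun _ v => ∀ i, i < len (v 0) → GuessAt T i (ent (v 0) i) ∧
    (i + 1 < len (v 0) → GuessStep P (ent (v 0) i) (guess (ent (v 0) (i + 1)))))).neg⟩

end

section

variable {S : Set (Set N)} {T P : Set N}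

theorem guessTree_mem (hS : RCA0 S) (hT : T ∈ S) (hP : P ∈ S) : guessTree T P ∈ S := by
  have := InModel.pairSets hS hT hP
  exact comprehension₂ hS hT hP _

theorem isTree_guessTree : IsTree (guessTree T P) := by
  intro c hc d hd
  obtain ⟨hl, he⟩ := initSeg_iff.1 hd
  intro i hi
  obtain ⟨h1, h2⟩ := hc i (hi.trans_le hl)
  rw [he i hi]
  refine ⟨h1, fun hi' => ?_⟩
  rw [he _ hi']
  exact h2 (hi'.trans_le hl)

/-- Being a path through `guessTree T P` is a local condition. -/
theorem isPath_guessTree (hS : RCA0 S) {y : N → N} : IsPath S (guessTree T P) (graph y) ↔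
    graph y ∈ S ∧ ∀ i, GuessAt T i (y i) ∧ GuessStep P (y i) (guess (y (i + 1))) := by
  constructor
  · refine fun h => ⟨h.1.1, fun i => ?_⟩
    obtain ⟨c, hc, hl, he⟩ := (isPath_graph.1 h).2 (i + 1 + 1)
    have hi := lt_succ_self' (i + 1)
    have hi' := (lt_succ_self' i).trans hi
    obtain ⟨h1, h2⟩ := hc i (hl ▸ hi')
    rw [he i hi'] at h1 h2
    rw [he _ hi] at h2
    exact ⟨h1, h2 (hl ▸ hi)⟩
  · rintro ⟨hy, h⟩
    refine isPath_graph.2 ⟨hy, fun n => ?_⟩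
    have := InModel.oneSet hS hy
    have : Comp (oneSet (graph y)) y := Comp.of_sgSet
    obtain ⟨c, rfl, hc⟩ := exists_seq (oneSet (graph y)) y n
    refine ⟨c, fun i hi => ?_, rfl, hc⟩
    rw [hc i hi]
    refine ⟨(h i).1, fun hi' => ?_⟩
    rw [hc _ hi']
    exact (h i).2

/-- A code of each initial segment of an infinite sequence, as a computable function. -/
theorem exists_initial (F : Unit → ℕ → Set N) [InModel F] (h : N → N) [Comp F h] :
    ∃ g : N → N, Comp F g ∧ ∀ n, len (g n) = n ∧ ∀ i, i < n → ent (g n) i = h i :=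
  exists_choice F (Q := fun n c => len c = n ∧ ∀ i, i < n → ent c i = h i) (exists_seq F h)

open Classical in
theorem illFounded_guessTree (hS : RCA0 S) (hTS : T ∈ S) (hT : IsTree T) (h : IllFounded S T) :
    IllFounded S (guessTree T P) := by
  obtain ⟨_, hp⟩ := h
  obtain ⟨h, rfl⟩ := hp.exists_graph
  let F := pairSets T (graph h)
  have hF : InModel F := InModel.pairSets hS hTS hp.1.1
  have hFS : ∀ n, F () n ∈ S := pairSets_mem hTS hp.1.1
  have : Comp F h := Comp.of_sgSet
  obtain ⟨g, hg, hgs⟩ := exists_initial F h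
  let y : N → N := fun i => pair (pair (g (i + 1)) (if i ∈ T then 1 else 0)) 1
  have : Comp F y := ⟨inferInstanceAs
    (Fn F (fun _ v => pair (pair (g (v 0 + 1)) (if v 0 ∈ T then 1 else 0)) 1))⟩
  refine ⟨graph y, (isPath_guessTree hS).2 ⟨graph_mem hS hFS,
    fun i => ⟨⟨⟨?_, ?_, ?_⟩, ?_, ?_⟩, ?_⟩⟩⟩
  · simp only [y, guess, fst_pair]
    exact hp.mem_of_eq hT fun j hj => (hgs _).2 j ((hgs (i + 1)).1 ▸ hj)
  · simp only [y, guess, fst_pair, (hgs _).1]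
    exact zero_le.trans_lt (lt_succ_self' i)
  · rintro rfl
    simp [y, guess, (hgs _).1]
  · by_cases hi : i ∈ T <;> simp [y, recorded, hi]
  · simp [y, final]
  · refine .inl ⟨by simp [y, final], by simp [y, guess, (hgs _).1], fun j hj => ?_⟩
    simp only [y, guess, fst_pair, (hgs _).1] at hj ⊢
    rw [(hgs _).2 j hj, (hgs _).2 j (hj.trans (lt_succ_self' _))]

/-! ### Paths through the tree of guesses -/

section Path

variable {y : N → N} (hy : ∀ i, GuessAt T i (y i) ∧ GuessStep P (y i) (guess (y (i + 1))))

include hy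

/-- The entries of `y` record the tree `T`. -/
theorem recorded_eq_one_iff (i : N) : recorded (y i) = 1 ↔ i ∈ T := by
  rcases (hy i).1.2.1 with ⟨h, h'⟩ | ⟨h, h'⟩ <;> simp [h, h']

variable (F : Unit → ℕ → Set N) [InModel F] [hyF : Comp F y]

include F

/-- Final entries are not changed later. -/
theorem guess_of_final {i : N} (hi : final (y i) = 1) {k : N} (hk : i < k) :
    len (guess (y i)) < len (guess (y k)) ∧
      ∀ j, j < len (guess (y i)) → ent (guess (y k)) j = ent (guess (y i)) j := by
  obtain ⟨d, rfl⟩ := exists_add_of_le (succ_le_iff_lt.2 hk)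
  clear hk
  refine Sg.induction F (P := fun d => len (guess (y i)) < len (guess (y (i + 1 + d))) ∧
      ∀ j, j < len (guess (y i)) → ent (guess (y (i + 1 + d))) j = ent (guess (y i)) j) ?_ ?_ d
  · rw [add_zero]
    rcases (hy i).2 with ⟨-, h1, h2⟩ | ⟨h, -⟩
    · exact ⟨h1 ▸ lt_succ_self' _, h2⟩
    · exact (zero_ne_one (h.symm.trans hi)).elim
  · rintro d ⟨h1, h2⟩
    rw [← add_assoc]
    rcases (hy (i + 1 + d)).2 with ⟨-, h3, h4⟩ | ⟨-, h3, h4⟩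
    · exact ⟨h3 ▸ h1.trans (lt_succ_self' _), fun j hj => (h4 j (hj.trans h1)).trans (h2 j hj)⟩
    · exact ⟨h3 ▸ h1, fun j hj => ((h4 j (hj.trans h1)).1
        ((succ_le_iff_lt.2 hj).trans_lt h1)).trans (h2 j hj)⟩

/-- While no entry is final, only the last entry of the guess changes. -/
theorem len_guess_of_not_final (i D : N) (h : ∀ d, d < D → final (y (i + d)) = 0) :
    len (guess (y (i + D))) = len (guess (y i)) := by
  revert h
  refine Sg.induction F (P := fun D => (∀ d, d < D → final (y (i + d)) = 0) →
    len (guess (y (i + D))) = len (guess (y i))) (fun _ => by rw [add_zero]) ?_ D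
  intro D ih h
  rw [← ih fun d hd => h d (hd.trans (lt_succ_self' D)), ← add_assoc]
  rcases (hy (i + D)).2 with ⟨h1, -⟩ | ⟨-, h2, -⟩
  · exact (zero_ne_one ((h D (lt_succ_self' D)).symm.trans h1)).elim
  · exact h2

/-- Every guess is replaced only finitely often, as `P` is well-founded. -/
theorem exists_final (hS : RCA0 S) (hFS : ∀ n, F () n ∈ S) (hwf : WellFoundedIn S P) (i : N) :
    ∃ k, final (y k) = 1 ∧ len (guess (y k)) = len (guess (y i)) := by
  have h01 : ∀ k, final (y k) ≠ 1 → final (y k) = 0 := fun k hk => (hy k).1.2.2.resolve_right hk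
  by_cases hex : ∃ d, final (y (i + d)) = 1
  · obtain ⟨d, hd, hd'⟩ := exists_least F (P := fun d => final (y (i + d)) = 1) hex
    exact ⟨i + d, hd, len_guess_of_not_final hy F i d fun e he => h01 _ (hd' e he)⟩
  · rw [not_exists] at hex
    have hl := fun D => len_guess_of_not_final hy F i D fun e _ => h01 _ (hex e)
    obtain ⟨l, hl0⟩ := exists_add_of_le (succ_le_iff_lt.2 (hy i).1.1.2.1)
    have hl0 : len (guess (y i)) = l + 1 := by rw [hl0]; ring
    have : Comp F (fun d => ent (guess (y (i + d))) l) := ⟨inferInstance⟩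
    refine (hwf.not_descending (graph_mem hS hFS (h := fun d => ent (guess (y (i + d))) l))
      fun d => ?_).elim
    rcases (hy (i + d)).2 with ⟨h1, -⟩ | ⟨-, -, h2⟩
    · exact (hex d h1).elim
    · rw [hl, hl0] at h2
      rw [← add_assoc]
      exact (h2 l (lt_succ_self' l)).2 rfl

theorem exists_final_len (hS : RCA0 S) (hFS : ∀ n, F () n ∈ S) (hwf : WellFoundedIn S P) :
    ∀ k, ∃ i, final (y i) = 1 ∧ len (guess (y i)) = k + 1 := by
  refine Sg.induction F (P := fun k => ∃ i, final (y i) = 1 ∧ len (guess (y i)) = k + 1) ?_ ?_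
  · obtain ⟨k, h1, h2⟩ := exists_final hy F hS hFS hwf 0
    exact ⟨k, h1, by rw [h2, (hy 0).1.1.2.2 rfl, zero_add]⟩
  · rintro k ⟨i, h1, h2⟩
    obtain ⟨i', h3, h4⟩ := exists_final hy F hS hFS hwf (i + 1)
    refine ⟨i', h3, ?_⟩
    rcases (hy i).2 with ⟨-, h5, -⟩ | ⟨h5, -⟩
    · rw [h4, h5, h2]
    · exact (zero_ne_one (h5.symm.trans h1)).elim

theorem final_unique {i k : N} (hi : final (y i) = 1) (hk : final (y k) = 1)
    (h : len (guess (y i)) = len (guess (y k))) : i = k := by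
  rcases lt_trichotomy i k with hl | hl | hl
  · exact ((guess_of_final hy F hi hl).1.ne h).elim
  · exact hl
  · exact ((guess_of_final hy F hk hl).1.ne h.symm).elim

end Path

/-- A path `y` through the tree of guesses computes the tree `T` and a path `h` through it. If a
path `h'` is `P`-below `h`, then `y` and `h'` compute a path to the left of `y`. -/
theorem exists_path_of_guessTree (hS : RCA0 S) (hT : IsTree T) (hwf : WellFoundedIn S P)
    {y : N → N} (hp : IsPath S (guessTree T P) (graph y)) :
    ∃ h : N → N, IsPath S T (graph h) ∧
      (∀ (F : Unit → ℕ → Set N) [Comp F y], SgSet F T ∧ PgSet F T ∧ Comp F h) ∧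
      ∀ h' : N → N, IsPath S T (graph h') → LexBelow (rel P) (graph h') (graph h) →
        ∀ (F : Unit → ℕ → Set N) [InModel F] [Comp F y] [Comp F h'], (∀ n, F () n ∈ S) →
          ∃ y' : N → N, Comp F y' ∧ IsPath S (guessTree T P) (graph y') ∧
            LexBelow (fun a b => a < b) (graph y') (graph y) := by
  obtain ⟨hyS, hy⟩ := (isPath_guessTree hS).1 hp
  let F₀ := oneSet (graph y)
  have hF₀ : InModel F₀ := InModel.oneSet hS hyS
  have hFS₀ : ∀ n, F₀ () n ∈ S := fun _ => hyS
  have hyF₀ : Comp F₀ y := Comp.of_sgSet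
  choose idx hf hl using exists_final_len hy F₀ hS hFS₀ hwf
  let h : N → N := fun k => ent (guess (y (idx k))) k
  have hcomp : ∀ (F : Unit → ℕ → Set N) [Comp F y], Comp F h := by
    refine fun F _ => ⟨⟨Sg.congr (P := fun _ v => ∃ i, final (y i) = 1 ∧
      len (guess (y i)) = v 1 + 1 ∧ v 0 = ent (guess (y i)) (v 1)) inferInstance fun _ v => ?_⟩⟩
    constructor
    · exact fun e => ⟨idx (v 1), hf _, hl _, e⟩
    · rintro ⟨i, h1, h2, h3⟩
      rw [h3, final_unique hy F₀ h1 (hf (v 1)) (h2.trans (hl _).symm)]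
      rfl
  have hguess : ∀ k j, j < k + 1 → ent (guess (y (idx k))) j = h j := by
    intro k j hj
    rcases (lt_succ_iff_le.1 hj).lt_or_eq with hj | rfl
    · have hlt : idx j < idx k := by
        by_contra! hle
        have : len (guess (y (idx k))) ≤ len (guess (y (idx j))) := by
          rcases hle.lt_or_eq with hle | hle
          · exact (guess_of_final hy F₀ (hf k) hle).1.le
          · rw [hle]
        rw [hl, hl] at this
        exact absurd (le_of_add_le_add_right this) (not_le.2 hj)
      exact (guess_of_final hy F₀ (hf j) hlt).2 j (by rw [hl]; exact lt_succ_self' j)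
    · rfl
  have hhS : graph h ∈ S := by
    have := hcomp F₀
    exact graph_mem hS hFS₀
  refine ⟨h, isPath_graph.2 ⟨hhS, fun n => ?_⟩, fun F _ => ⟨⟨?_⟩, ⟨?_⟩, hcomp F⟩, ?_⟩
  · have := hcomp F₀
    obtain ⟨c, rfl, hc⟩ := exists_seq F₀ h n
    refine ⟨c, hT _ (hy (idx (len c))).1.1.1 c (initSeg_iff.2 ⟨?_, fun i hi => ?_⟩), rfl, hc⟩
    · rw [hl]; exact (lt_succ_self' _).le
    · rw [hc i hi, hguess _ _ (hi.trans (lt_succ_self' _))]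
  · exact Sg.congr (P := fun _ v => recorded (y (v 0)) = 1) inferInstance
      fun _ v => (recorded_eq_one_iff hy _).symm
  · exact Sg.congr (P := fun _ v => ¬ recorded (y (v 0)) = 1) inferInstance
      fun _ v => not_congr (recorded_eq_one_iff hy _).symm
  · intro h' hp' hbelow F _ _ _ hFS
    obtain ⟨k, hk, hagree⟩ := lexBelow_graph.1 hbelow
    obtain ⟨g, hg, hgs⟩ := exists_initial F h'
    generalize hi₀ : idx k = i₀
    have hfin : final (y i₀) = 1 := hi₀ ▸ hf k
    have hlen : len (guess (y i₀)) = k + 1 := hi₀ ▸ hl k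
    have hent : ∀ j, j < k + 1 → ent (guess (y i₀)) j = h j := hi₀ ▸ hguess k
    -- The new path reopens the guess that `y` makes final at `i₀`, and follows `h'` afterwards.
    obtain ⟨y', hy', hQ⟩ := exists_choice F (Q := fun m z => (m < i₀ ∧ z = y m) ∨
      (m = i₀ ∧ z = pair (fst (y i₀)) 0) ∨ ∃ d, d ≤ m ∧ m = i₀ + 1 + d ∧
        z = pair (pair (g (k + 1 + d)) (recorded (y m))) 1) (fun m => by
      rcases lt_trichotomy m i₀ with hm | hm | hm
      · exact ⟨_, .inl ⟨hm, rfl⟩⟩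
      · exact ⟨_, .inr (.inl ⟨hm, rfl⟩)⟩
      · obtain ⟨d, rfl⟩ := exists_add_of_le (succ_le_iff_lt.2 hm)
        exact ⟨_, .inr (.inr ⟨d, le_add_self, rfl, rfl⟩)⟩)
    have hlt : ∀ d, i₀ < i₀ + 1 + d := fun d => (lt_succ_self' i₀).trans_le le_self_add
    have h1 : ∀ m, m < i₀ → y' m = y m := by
      intro m hm
      rcases hQ m with ⟨-, e⟩ | ⟨e, -⟩ | ⟨d, -, e, -⟩
      · exact e
      · exact (hm.ne e).elim
      · exact (lt_asymm hm (e ▸ hlt d)).elim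
    have h2 : y' i₀ = pair (fst (y i₀)) 0 := by
      rcases hQ i₀ with ⟨e, -⟩ | ⟨-, e⟩ | ⟨d, -, e, -⟩
      · exact (lt_irrefl _ e).elim
      · exact e
      · exact ((hlt d).ne e).elim
    have h3 : ∀ d, y' (i₀ + 1 + d) =
        pair (pair (g (k + 1 + d)) (recorded (y (i₀ + 1 + d)))) 1 := by
      intro d
      rcases hQ (i₀ + 1 + d) with ⟨e, -⟩ | ⟨e, -⟩ | ⟨d', -, e, e'⟩
      · exact (lt_asymm e (hlt d)).elim
      · exact ((hlt d).ne e.symm).elim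
      · rw [e', add_left_cancel e]
    refine ⟨y', hy', (isPath_guessTree hS).2 ⟨graph_mem hS hFS, fun m => ?_⟩,
      lexBelow_graph.2 ⟨i₀, ?_, h1⟩⟩
    · rcases lt_trichotomy m i₀ with hm | rfl | hm
      · refine ⟨h1 m hm ▸ (hy m).1, ?_⟩
        rw [h1 m hm]
        rcases (succ_le_iff_lt.2 hm).lt_or_eq with hm' | hm'
        · rw [h1 _ hm']; exact (hy m).2
        · have : guess (y' (m + 1)) = guess (y (m + 1)) := by
            rw [hm', h2, guess, fst_pair, guess]
          rw [this]; exact (hy m).2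
      · have hg0 : guess (y' m) = guess (y m) := by rw [h2, guess, fst_pair, guess]
        have hfin0 : final (y' m) = 0 := by rw [h2, final, snd_pair]
        refine ⟨⟨?_, ?_, .inl hfin0⟩, .inr ⟨hfin0, ?_⟩⟩
        · rw [hg0]; exact (hy m).1.1
        · rw [h2, recorded, fst_pair]; exact (hy m).1.2.1
        · have := h3 0
          rw [add_zero, add_zero] at this
          rw [hg0, this, hlen, guess, fst_pair, fst_pair]
          refine ⟨(hgs _).1, fun j hj => ⟨fun hj' => ?_, fun hj' => ?_⟩⟩
          · rw [(hgs _).2 j hj, hent j hj]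
            exact hagree j (lt_of_add_lt_add_right hj')
          · rw [(hgs _).2 j hj, hent j hj, add_right_cancel hj']
            exact hk
      · obtain ⟨d, rfl⟩ := exists_add_of_le (succ_le_iff_lt.2 hm)
        have hg0 : guess (y' (i₀ + 1 + d)) = g (k + 1 + d) := by
          rw [h3, guess, fst_pair, fst_pair]
        have hg1 : guess (y' (i₀ + 1 + d + 1)) = g (k + 1 + d + 1) := by
          rw [add_assoc (i₀ + 1), h3, guess, fst_pair, fst_pair, add_assoc (k + 1)]
        have hfin1 : final (y' (i₀ + 1 + d)) = 1 := by rw [h3, final, snd_pair]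
        refine ⟨⟨⟨?_, ?_, ?_⟩, ?_, .inr hfin1⟩, .inl ⟨hfin1, ?_, fun j hj => ?_⟩⟩
        · rw [hg0]
          exact hp'.mem_of_eq hT fun j hj => (hgs _).2 j ((hgs (k + 1 + d)).1 ▸ hj)
        · rw [hg0, (hgs _).1]
          exact (zero_le.trans_lt (lt_succ_self' k)).trans_le le_self_add
        · exact fun e => (not_lt_zero' i₀ (e ▸ hm)).elim
        · rw [h3, recorded, fst_pair, snd_pair]
          exact (hy _).1.2.1
        · rw [hg0, hg1, (hgs _).1, (hgs _).1]
        · rw [hg0, (hgs _).1] at hj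
          rw [hg0, hg1, (hgs _).2 j hj, (hgs _).2 j (hj.trans (lt_succ_self' _))]
    · rw [h2]
      have : y i₀ = pair (fst (y i₀)) 1 := by rw [← hfin, final, pair_fst_snd]
      rw [this, fst_pair]
      exact pair_zero_lt_pair_one _

end

end

section

variable {N : Type u} [RCA0Numbers N] {S : Set (Set N)}

/-! ### Relative computability -/

theorem ceIn_of_sgSet {W Z : Set N} [h : SgSet (oneSet Z) W] : CEIn W Z := by
  obtain ⟨φ, hφ⟩ := h.out.exists_sigmaOne
  obtain ⟨p, hp⟩ := hφ (fun _ => 0)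
  exact ⟨φ, p, Set.ext fun n => (hp () n).symm⟩

/-- A set computably enumerable in `Z` is computably enumerable in all sets that compute `Z`. -/
theorem CEIn.sgSet {I : Type w} {F : I → ℕ → Set N} [InModel F] {W Z : Set N} (h : CEIn W Z)
    [hZ : SgSet F Z] [hZ' : PgSet F Z] : SgSet F W := by
  obtain ⟨φ, p, rfl⟩ := h
  exact ⟨sg_sigmaOne (X := fun _ _ _ => Z) (fun _ => hZ.out) (fun _ => hZ'.out) φ p
    (fun _ v => v 0)⟩

theorem SgSet.trans {I : Type w} {F : I → ℕ → Set N} [InModel F] {W Z : Set N}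
    [SgSet F Z] [PgSet F Z] (h : SgSet (oneSet Z) W) : SgSet F W :=
  ceIn_of_sgSet.sgSet (Z := Z)

theorem PgSet.trans {I : Type w} {F : I → ℕ → Set N} [InModel F] {W Z : Set N}
    [SgSet F Z] [PgSet F Z] (h : PgSet (oneSet Z) W) : PgSet F W :=
  have : SgSet (oneSet Z) Wᶜ := ⟨h.out⟩
  ⟨(SgSet.trans (F := F) this).out⟩

theorem computableIn_of_pgSet {W Z : Set N} [SgSet (oneSet Z) W] [h : PgSet (oneSet Z) W] :
    ComputableIn W Z :=
  have : SgSet (oneSet Z) Wᶜ := ⟨h.out⟩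
  ⟨ceIn_of_sgSet, ceIn_of_sgSet⟩

section Join

variable {X Y : Set N}

theorem even_ne_odd (x y : N) : x + x ≠ y + y + 1 := by
  intro h
  have h1 : (1 : N) < 2 := by rw [← one_add_one_eq_two]; exact lt_succ_self' 1
  refine zero_ne_one (rem_unique (q := x) (q' := y) (m := (2 : N)) (r := 0) (r' := 1) ?_
    (zero_lt_one.trans h1) h1)
  rw [mul_two, mul_two, add_zero, h]

theorem even_or_odd (z : N) : (∃ x, z = x + x) ∨ ∃ y, z = y + y + 1 := by
  refine Sg.induction (someSets N) (P := fun z => (∃ x, z = x + x) ∨ ∃ y, z = y + y + 1)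
    (.inl ⟨0, by simp⟩) ?_ z
  rintro z (⟨x, rfl⟩ | ⟨x, rfl⟩)
  · exact .inr ⟨x, rfl⟩
  · exact .inl ⟨x + 1, by ring⟩

theorem add_self_injective {x y : N} (h : x + x = y + y) : x = y := by
  rcases lt_trichotomy x y with hl | hl | hl
  · exact ((add_lt_add hl hl).ne h).elim
  · exact hl
  · exact ((add_lt_add hl hl).ne h.symm).elim

theorem even_mem_join {x : N} : x + x ∈ join X Y ↔ x ∈ X := by
  constructor
  · rintro (⟨x', hx, e⟩ | ⟨y, hy, e⟩)
    · rwa [add_self_injective e]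
    · exact (even_ne_odd _ _ e).elim
  · exact fun h => .inl ⟨x, h, rfl⟩

theorem odd_mem_join {y : N} : y + y + 1 ∈ join X Y ↔ y ∈ Y := by
  constructor
  · rintro (⟨x', hx, e⟩ | ⟨y', hy, e⟩)
    · exact (even_ne_odd _ _ e.symm).elim
    · rwa [add_self_injective (add_right_cancel e)]
  · exact fun h => .inr ⟨y, h, rfl⟩

theorem compl_join : (join X Y)ᶜ = join Xᶜ Yᶜ := by
  ext z
  rcases even_or_odd z with ⟨x, rfl⟩ | ⟨y, rfl⟩
  · rw [Set.mem_compl_iff, even_mem_join, even_mem_join, Set.mem_compl_iff]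
  · rw [Set.mem_compl_iff, odd_mem_join, odd_mem_join, Set.mem_compl_iff]

variable {I : Type w} {F : I → ℕ → Set N}

instance [SgSet F X] [SgSet F Y] : SgSet F (join X Y) :=
  ⟨(inferInstance : Sg F (fun _ v => (∃ x, x ∈ X ∧ v 0 = x + x) ∨ ∃ y, y ∈ Y ∧ v 0 = y + y + 1))⟩

instance [h : PgSet F X] [h' : PgSet F Y] : PgSet F (join X Y) := by
  have : SgSet F Xᶜ := ⟨h.out⟩
  have : SgSet F Yᶜ := ⟨h'.out⟩
  have h : SgSet F (join X Y)ᶜ := compl_join (X := X) (Y := Y) ▸ inferInstance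
  exact ⟨h.out⟩

theorem SgSet.of_join_left [SgSet F (join X Y)] : SgSet F X :=
  ⟨Sg.congr (P := fun _ v => v 0 + v 0 ∈ join X Y) inferInstance fun _ _ => even_mem_join.symm⟩

theorem SgSet.of_join_right [SgSet F (join X Y)] : SgSet F Y :=
  ⟨Sg.congr (P := fun _ v => v 0 + v 0 + 1 ∈ join X Y) inferInstance fun _ _ => odd_mem_join.symm⟩

theorem PgSet.of_join_right [PgSet F (join X Y)] : PgSet F Y :=
  ⟨Sg.congr (P := fun _ v => ¬ v 0 + v 0 + 1 ∈ join X Y) inferInstance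
    fun _ _ => not_congr odd_mem_join.symm⟩

theorem join_mem (hS : RCA0 S) (hX : X ∈ S) (hY : Y ∈ S) : join X Y ∈ S :=
  comprehension₂ hS hX hY _

end Join

/-! ### Jump hierarchies -/

section Hierarchy

variable {θ : BFormula} {B R : Set N}

theorem mem_part {Y : Set N} {j z : N} : z ∈ part R Y j ↔ z ∈ Y ∧ rel R (snd z) j := by
  refine and_congr Iff.rfl ⟨?_, fun h => ⟨fst z, snd z, (pair_fst_snd z).symm, h⟩⟩
  rintro ⟨m, i, rfl, h⟩
  rwa [snd_pair]

theorem part_mem (hS : RCA0 S) (hR : R ∈ S) {Y : Set N} (hY : Y ∈ S) (j : N) : part R Y j ∈ S := by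
  have h : part R Y j = {z | z ∈ Y ∧ rel R (snd z) j} := Set.ext fun z => mem_part
  rw [h]
  have : SgSet (pairSets R Y) {z | z ∈ Y ∧ rel R (snd z) j} :=
    ⟨(inferInstance : Sg _ (fun _ v => v 0 ∈ Y ∧ rel R (snd (v 0)) j))⟩
  have : PgSet (pairSets R Y) {z | z ∈ Y ∧ rel R (snd z) j} :=
    ⟨(inferInstance : Pg _ (fun _ v => v 0 ∈ Y ∧ rel R (snd (v 0)) j)).neg⟩
  exact comprehension₂ hS hR hY _

/-- Along a well-founded order there is at most one hierarchy of jumps: from a difference between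
two of them, smaller and smaller differences could be found. -/
theorem IsHierarchy.unique (hS : RCA0 S) (hR : R ∈ S) (hwf : WellFoundedIn S R) {Y₁ Y₂ Z : Set N}
    (h₁ : Y₁ ∈ S) (h₂ : Y₂ ∈ S) (H₁ : IsHierarchy θ B R Y₁ Z) (H₂ : IsHierarchy θ B R Y₂ Z) :
    Y₁ = Y₂ := by
  let D : Set N := {z | ¬ (z ∈ Y₁ ↔ z ∈ Y₂)}
  have : SgSet (pairSets Y₁ Y₂) D :=
    ⟨(inferInstance : Sg _ (fun _ v => ¬ (v 0 ∈ Y₁ ↔ v 0 ∈ Y₂)))⟩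
  have : PgSet (pairSets Y₁ Y₂) D :=
    ⟨(inferInstance : Sg _ (fun _ v => ¬ ¬ (v 0 ∈ Y₁ ↔ v 0 ∈ Y₂)))⟩
  have hD : D ∈ S := comprehension₂ hS h₁ h₂ D
  have hempty : D = ∅ := by
    refine hwf.eq_empty hS hR hD fun z hz => ?_
    by_contra! hno
    have hpart : part R Y₁ (snd z) = part R Y₂ (snd z) := by
      ext x
      rw [mem_part, mem_part]
      by_cases hx : rel R (snd x) (snd z)
      · simp only [hx, and_true]
        by_contra hne
        exact hno x hne hx
      · simp [hx]
    apply hz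
    rw [← pair_fst_snd z, H₁, H₂, hpart]
  ext z
  by_contra hz
  exact (Set.ext_iff.1 hempty z).1 hz

/-- If `Z` is computable in `Z'`, then a hierarchy of jumps of `Z'` computes one of `Z`. Its columns
are reduced to those of the given hierarchy by one computable function `m ↦ (e, (e, m))`, whose
index `e` is found by the recursion theorem; hence no transfinite induction is needed. -/
theorem IsHierarchy.exists_of_computable (hS : RCA0 S) (hθ : IsUniversal S θ) (hR : R ∈ S)
    {Y' Z Z' : Set N} (hZ' : Z' ∈ S) (hsg : SgSet (oneSet Z') Z) (hpg : PgSet (oneSet Z') Z)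
    (hY' : Y' ∈ S) (H : IsHierarchy θ B R Y' Z') :
    ∃ Y, Y ∈ S ∧ IsHierarchy θ B R Y Z ∧
      ∀ (F : Unit → ℕ → Set N) [SgSet F Y'] [PgSet F Y'], SgSet F Y ∧ PgSet F Y := by
  let F : {Y // Y ∈ S} → ℕ → Set N := fun Y => twoSets Y.1 Z'
  have hF : InModel F := ⟨S, hS, fun Y n => by
    rcases n with _ | n
    exacts [Y.2, hZ']⟩
  have : SgSet F Z' := ⟨Sg.inst_mem_base (F := F) (n := 1)⟩
  have : PgSet F Z' := ⟨(Pg.inst_mem_base (F := F) (n := 1)).neg⟩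
  have hZsg : SgSet F Z := SgSet.trans hsg
  have hZpg : PgSet F Z := PgSet.trans hpg
  -- The formula `θ(m, {(n, i) | ((d, (d, n)), i) ∈ Y}, Z)` in the variable `x = (d, m)`.
  have key : Sg F (fun Y v => SigmaOne θ
      (fun n => twoSets {z | pair (pair (fst (v 0)) (pair (fst (v 0)) (fst z))) (snd z) ∈ Y.1} Z n)
      (fun _ => 0) (snd (v 0))) := by
    refine sg_sigmaOne (F := F) (X := fun n (Y : {Y // Y ∈ S}) v =>
      twoSets {z | pair (pair (fst (v 0)) (pair (fst (v 0)) (fst z))) (snd z) ∈ Y.1} Z n)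
      (fun n => ?_) (fun n => ?_) θ (fun _ => 0) (fun _ v => snd (v 0))
    · rcases n with _ | n
      · exact (inferInstance : Sg F (fun Y v => pair (pair (fst (tail v 0)) (pair (fst (tail v 0))
          (fst (v 0)))) (snd (v 0)) ∈ F Y 0))
      · exact hZsg.out
    · rcases n with _ | n
      · exact (inferInstance : Sg F (fun Y v => ¬ pair (pair (fst (tail v 0)) (pair (fst (tail v 0))
          (fst (v 0)))) (snd (v 0)) ∈ F Y 0))
      · exact hZpg.out
  obtain ⟨φ, hφ⟩ := key.exists_sigmaOne
  obtain ⟨p, hp⟩ := hφ (fun _ => 0)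
  obtain ⟨e, he⟩ := hθ φ p
  have hfix : ∀ m X, X ∈ S → (SigmaOneAt θ (pair e (pair e m)) X Z' ↔
      SigmaOneAt θ m {z | pair (pair e (pair e (fst z))) (snd z) ∈ X} Z) := by
    intro m X hX
    rw [← he _ X hX Z' hZ']
    refine (hp ⟨X, hX⟩ (pair e m)).trans ?_
    simp only [push_zero, fst_pair, snd_pair]
    rfl
  let Y : Set N := {z | pair (pair e (pair e (fst z))) (snd z) ∈ Y'}
  have hY : ∀ (F : Unit → ℕ → Set N) [SgSet F Y'] [PgSet F Y'], SgSet F Y ∧ PgSet F Y :=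
    fun F _ _ => ⟨⟨(inferInstance : Sg F (fun _ v =>
      pair (pair e (pair e (fst (v 0)))) (snd (v 0)) ∈ Y'))⟩, ⟨(inferInstance : Sg F (fun _ v =>
      ¬ pair (pair e (pair e (fst (v 0)))) (snd (v 0)) ∈ Y'))⟩⟩
  refine ⟨Y, ?_, fun m j => ?_, hY⟩
  · obtain ⟨h1, h2⟩ := hY (oneSet Y')
    exact comprehension (F := oneSet Y') hS (fun _ => hY') Y
  · have h1 : pair m j ∈ Y ↔ pair (pair e (pair e m)) j ∈ Y' := by
      simp only [Y, Set.mem_ofPred_eq, fst_pair, snd_pair]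
    have h2 : {z | pair (pair e (pair e (fst z))) (snd z) ∈ part R Y' j} = part R Y j := by
      ext z
      simp only [Set.mem_ofPred_eq, mem_part, snd_pair, Y]
    rw [h1, H, hfix _ _ (part_mem hS hR hY' j), h2]

end Hierarchy

end

section

variable {N : Type u} [RCA0Numbers N] {S : Set (Set N)}

/-! ### Leftmost and minimal paths -/

/-- The usual order as a set of the model. -/
def ltSet (N : Type u) [RCA0Numbers N] : Set N := {z | fst z < snd z}

theorem rel_ltSet : rel (ltSet N) = fun x y : N => x < y := by
  funext x y
  simp [rel, ltSet]

theorem ltSet_mem (hS : RCA0 S) : ltSet N ∈ S := by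
  obtain ⟨X, hX⟩ := hS.sets_nonempty
  have : SgSet (oneSet X) (ltSet N) :=
    ⟨(inferInstance : Sg (oneSet X) (fun _ v => fst (v 0) < snd (v 0)))⟩
  have : PgSet (oneSet X) (ltSet N) :=
    ⟨(inferInstance : Sg (oneSet X) (fun _ v => ¬ fst (v 0) < snd (v 0)))⟩
  exact comprehension (F := oneSet X) hS (fun _ => hX) _

theorem isPartialOrder_ltSet : IsPartialOrder (ltSet N) := by
  unfold IsPartialOrder
  rw [rel_ltSet]
  exact ⟨fun x y z => lt_trans, lt_irrefl⟩

theorem wellFoundedIn_ltSet (hS : RCA0 S) : WellFoundedIn S (ltSet N) := by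
  rintro ⟨X, hX, hd⟩
  obtain ⟨h, rfl, hh⟩ := isInfSeq_iff.1 hX
  have hF : InModel (oneSet (graph h)) := InModel.oneSet hS hh
  have hc : Comp (oneSet (graph h)) h := Comp.of_sgSet
  have hd : ∀ i, h (i + 1) < h i := fun i => by
    have := hd i _ _ (pair_mem_graph.2 rfl) (pair_mem_graph.2 rfl)
    rwa [rel_ltSet] at this
  have key : ∀ i, h i + i ≤ h 0 := by
    refine Sg.induction (oneSet (graph h)) (P := fun i => h i + i ≤ h 0) (by rw [add_zero]) ?_
    intro i hi
    refine le_trans ?_ hi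
    calc h (i + 1) + (i + 1) = h (i + 1) + 1 + i := by ring
      _ ≤ h i + i := add_le_add_left (succ_le_iff_lt.2 (hd i)) i
  exact absurd (key (h 0 + 1)) (not_le.2 ((lt_succ_self' _).trans_le le_add_self))

theorem lpp_of_mpp (hS : RCA0 S) (h : MPP S) : LPP S := fun T hT hT' hI =>
  rel_ltSet (N := N) ▸ h T hT hT' hI _ (ltSet_mem hS) isPartialOrder_ltSet (wellFoundedIn_ltSet hS)

theorem sigmaLPP_of_sigmaMPP (hS : RCA0 S) {θ : BFormula} {A R : Set N} (h : SigmaMPP S θ A R) :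
    SigmaLPP S θ A R := fun T hT hT' hI =>
  rel_ltSet (N := N) ▸ h T hT hT' hI _ (ltSet_mem hS) isPartialOrder_ltSet (wellFoundedIn_ltSet hS)

theorem mpp_of_lpp (hS : RCA0 S) (h : LPP S) : MPP S := by
  intro T hT hTree hI P hP _ hwf
  obtain ⟨Λ, hp, hmin⟩ := h _ (guessTree_mem hS hT hP) isTree_guessTree
    (illFounded_guessTree hS hT hTree hI)
  obtain ⟨y, rfl⟩ := hp.exists_graph
  obtain ⟨f, hf, -, hbelow⟩ := exists_path_of_guessTree hS hTree hwf hp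
  refine ⟨graph f, hf, ?_⟩
  rintro ⟨Λ', hp', hlt⟩
  obtain ⟨f', rfl⟩ := hp'.exists_graph
  have hF := InModel.pairSets hS hp.1.1 hp'.1.1
  have hy : Comp (pairSets (graph y) (graph f')) y := Comp.of_sgSet
  have hf' : Comp (pairSets (graph y) (graph f')) f' := Comp.of_sgSet
  obtain ⟨y', -, h1, h2⟩ := hbelow f' hp' hlt _ (pairSets_mem hp.1.1 hp'.1.1)
  exact hmin ⟨_, h1, h2⟩

/-- A path to the left of `y` that is obtained from a path `Σ_α` in `T ⊕ f` is `Σ_α` in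
`guessTree T P ⊕ y`, since the hierarchy on the latter computes the unique hierarchy on the
former. -/
theorem sigmaMPP_of_sigmaLPP (hS : RCA0 S) {θ : BFormula} (hθ : IsUniversal S θ) {A R : Set N}
    (hR : R ∈ S) (hRwf : WellFoundedIn S R) (h : SigmaLPP S θ A R) : SigmaMPP S θ A R := by
  intro T hT hTree hI P hP _ hwf
  obtain ⟨Λ, hp, ⟨Y', hY'S, hY'⟩, hmin⟩ := h _ (guessTree_mem hS hT hP) isTree_guessTree
    (illFounded_guessTree hS hT hTree hI)
  obtain ⟨y, rfl⟩ := hp.exists_graph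
  obtain ⟨f, hf, hcomp, hbelow⟩ := exists_path_of_guessTree hS hTree hwf hp
  have hZ' := join_mem hS (guessTree_mem hS hT hP) hp.1.1
  -- Whatever computes the path `y` computes `T ⊕ f`.
  have hZcomp : ∀ (F : Unit → ℕ → Set N) [SgSet F (graph y)],
      SgSet F (join T (graph f)) ∧ PgSet F (join T (graph f)) := by
    intro F _
    have : Comp F y := Comp.of_sgSet
    obtain ⟨h1, h2, h3⟩ := hcomp F
    exact ⟨inferInstance, inferInstance⟩
  have hy₀ : SgSet (oneSet (join (guessTree T P) (graph y))) (graph y) :=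
    SgSet.of_join_right (X := guessTree T P)
  obtain ⟨Y, hYS, hY, hYcomp⟩ :=
    hY'.exists_of_computable hS hθ hR hZ' (hZcomp _).1 (hZcomp _).2 hY'S
  refine ⟨graph f, hf, ⟨Y, hYS, hY⟩, ?_⟩
  rintro ⟨Λ', hp', ⟨Y₂, ⟨hY₂S, hY₂⟩, hce⟩, hlt⟩
  obtain ⟨f', rfl⟩ := hp'.exists_graph
  obtain rfl := hY.unique hS hR hRwf hYS hY₂S hY₂
  have hce : CEIn (graph f') (join (join T (graph f)) Y) := hce.elim (fun h => h.2) fun h => h.2.1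
  let F := oneSet (join (join (guessTree T P) (graph y)) Y')
  have hFS : ∀ n, F () n ∈ S := fun _ => join_mem hS hZ' hY'S
  have hF : InModel F := InModel.oneSet hS (hFS 0)
  have : SgSet F (join (guessTree T P) (graph y)) := SgSet.of_join_left (Y := Y')
  have hyF : SgSet F (graph y) := SgSet.of_join_right (X := guessTree T P)
  have hyc : Comp F y := Comp.of_sgSet
  have : SgSet F Y' := SgSet.of_join_right (X := join (guessTree T P) (graph y))
  have : PgSet F Y' := PgSet.of_join_right (X := join (guessTree T P) (graph y))
  obtain ⟨h1, h2⟩ := hYcomp F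
  obtain ⟨h3, h4⟩ := hZcomp F
  have hf' : SgSet F (graph f') := hce.sgSet
  have hfc : Comp F f' := Comp.of_sgSet
  obtain ⟨y', hy', hpy, hlty⟩ := hbelow f' hp' hlt F hFS
  refine hmin ⟨graph y', hpy, ⟨Y', ⟨hY'S, hY'⟩, ?_⟩, hlty⟩
  by_cases hsucc : IsSuccOrder A R
  · exact .inl ⟨hsucc, ceIn_of_sgSet⟩
  · exact .inr ⟨hsucc, computableIn_of_pgSet⟩

theorem lpp_iff_mpp_and_relative (hS : RCA0 S) : (LPP S ↔ MPP S) ∧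
    ∀ θ : BFormula, IsUniversal S θ →
      (∀ A R : Set N, IsWO S A R → (SigmaLPP S θ A R ↔ SigmaMPP S θ A R)) ∧
      (TLPP S θ ↔ TMPP S θ) := by
  refine ⟨⟨mpp_of_lpp hS, lpp_of_mpp hS⟩, fun θ hθ => ?_⟩
  have h : ∀ A R : Set N, IsWO S A R → (SigmaLPP S θ A R ↔ SigmaMPP S θ A R) := fun A R hA =>
    ⟨sigmaMPP_of_sigmaLPP hS hθ hA.mem hA.wellFounded, sigmaLPP_of_sigmaMPP hS⟩
  exact ⟨h, forall₃_congr h⟩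

end

end SecondOrderArith

theorem mainTheorem8 {N : Type*} [Zero N] [One N] [Add N] [Mul N] [LT N] (S : Set (Set N))
    (hS : SecondOrderArith.RCA0 S) :
    (SecondOrderArith.LPP S ↔ SecondOrderArith.MPP S) ∧
    ∀ θ : SecondOrderArith.BFormula, SecondOrderArith.IsUniversal S θ →
      (∀ A R : Set N, SecondOrderArith.IsWO S A R →
        (SecondOrderArith.SigmaLPP S θ A R ↔ SecondOrderArith.SigmaMPP S θ A R)) ∧
      (SecondOrderArith.TLPP S θ ↔ SecondOrderArith.TMPP S θ) :=
  @SecondOrderArith.lpp_iff_mpp_and_relative N hS.toRCA0Numbers S hS
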